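/- A Jordan loop in $\mathbb{R}^2$ is called piecewise analytic if it is the cyclic sequential concatenation of finitely many segments (with end-points) of regular analytic curves; kinks are allowed at the concatenation points. Let $D_1,\dots,D_N\subset\mathbb{R}^2$ be pairwise disjoint sets such that each $D_i$ either is a single point or is an extended object, i.e., a closed set bounded by a piecewise analytic Jordan loop $\partial D_i$ (so that $D_i$ is the union of the loop and of either its interior or its exterior). Put $D:=\bigcup_i D_i$. Orient $\partial D_i$ of every extended object so that $D_i$ is to the left, let $s_i$ be the arc length along $\partial D_i$ and let $\varkappa_i(s_i\pm)$ be the one-sided values of the signed curvature (non-negative on convexities of $D_i$ and negative on its concavities). A bridge is a straight line segment $[\boldsymbol{p}_1,\boldsymbol{p}_2]$ such that $[\boldsymbol{p}_1,\boldsymbol{p}_2]\cap D=\{\boldsymbol{p}_1,\boldsymbol{p}_2\}$ and, whenever one of the end-points $\boldsymbol{p}_j$ lies inside a smooth piece of the boundary of an extended object, the segment is normal to this boundary at $\boldsymbol{p}_j$. Here a smooth piece is a regular open arc of class $C^k$, where $k\in\{1,2,\dots,\infty,\omega\}$ is arbitrary but fixed ($C^\omega$ means analytic). A number $d_\star>0$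 is called bizarre if at least one of the following holds: (i) there is an extended object $D_i$ whose boundary contains infinitely many points at which $\varkappa_i(s_i+)=-1/d_\star$ or $\varkappa_i(s_i-)=-1/d_\star$; (ii) there are infinitely many points $\boldsymbol{r}\notin D$ such that $\operatorname{dist}(\boldsymbol{r},D)=d_\star$ and the set of the points of $D$ nearest to $\boldsymbol{r}$ is not a singleton; (iii) there exists a bridge of length $2d_\star$. Then the set of bizarre numbers $d_\star$ is finite (possibly empty). -/

import Mathlib

open Set Filter Topology

noncomputable section

namespace PlanarScene

/-- The Euclidean plane. -/
abbrev Plane : Type := EuclideanSpace ℝ (Fin 2)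

/-- Rotation of a planar vector by a right angle counterclockwise: if `v` is tangent to an oriented
curve, `rotLeft v` points to the left of the curve. -/
def rotLeft (v : Plane) : Plane := !₂[-v 1, v 0]

/-- Signed curvature of a regular parametrized curve, `det (γ', γ'') / ‖γ'‖ ^ 3`. This is the
coefficient `κ` in the Frenet-Serret equation `dτ/ds = κ n`, where `τ` is the unit tangent vector
and `n` is the unit normal to the left of the curve. -/
def signedCurvature (γ : ℝ → Plane) (t : ℝ) : ℝ :=
  (deriv γ t 0 * deriv (deriv γ) t 1 - deriv γ t 1 * deriv (deriv γ) t 0) / ‖deriv γ t‖ ^ 3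

/-- On the parameter interval `[a, b]`, the map `γ` traces a segment, with both end-points, of a
regular analytic curve. -/
def IsRegularAnalyticSegment (γ : ℝ → Plane) (a b : ℝ) : Prop :=
  a < b ∧ AnalyticOnNhd ℝ γ (Icc a b) ∧ ∀ t ∈ Icc a b, deriv γ t ≠ 0

/-- `L` is a piecewise analytic Jordan loop: the cyclic sequential concatenation of `n ≥ 1` segments
of regular analytic curves (each parametrized over `[0, 1]`; addition in `Fin n` is cyclic), without
self-intersections. -/
def IsPiecewiseAnalyticJordanLoop (L : Set Plane) : Prop :=
  ∃ (n : ℕ) (_ : NeZero n) (γ : Fin n → ℝ → Plane),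
    (∀ j, IsRegularAnalyticSegment (γ j) 0 1) ∧
    (∀ j, γ j 1 = γ (j + 1) 0) ∧
    (∀ i j, ∀ s ∈ Ico (0 : ℝ) 1, ∀ t ∈ Ico (0 : ℝ) 1, γ i s = γ j t → i = j ∧ s = t) ∧
    L = ⋃ j, γ j '' Icc (0 : ℝ) 1

/-- A point-wise object. -/
def IsPointObject (D : Set Plane) : Prop := ∃ p, D = {p}

/-- An extended object: a closed set bounded by a piecewise analytic Jordan loop. By the Jordan
curve theorem it consists of the loop and one of the two regions, either the interior or the
exterior one, into which the loop cuts the plane; non-emptiness of the interior of the set says that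
it is not the loop alone. -/
def IsExtendedObject (D : Set Plane) : Prop :=
  IsClosed D ∧ (interior D).Nonempty ∧ IsPiecewiseAnalyticJordanLoop (frontier D)

/-- The set `D` is to the left of the curve `γ` at the parameter value `t`. -/
def IsToTheLeft (D : Set Plane) (γ : ℝ → Plane) (t : ℝ) : Prop :=
  ∀ᶠ ε in 𝓝[>] (0 : ℝ),
    γ t + ε • rotLeft (deriv γ t) ∈ D ∧ γ t - ε • rotLeft (deriv γ t) ∉ D

/-- `κ` is one of the two one-sided signed curvatures `κ(s+)`, `κ(s-)` of the boundary of `D` at its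
point `x`, the boundary being oriented so that `D` is to the left: `x` is the initial point
(respectively, the end point) of a regular analytic segment of the so oriented boundary, whose
signed curvature there is `κ`. -/
def HasOneSidedCurvature (D : Set Plane) (x : Plane) (κ : ℝ) : Prop :=
  ∃ (γ : ℝ → Plane) (a b : ℝ), IsRegularAnalyticSegment γ a b ∧
    γ '' Icc a b ⊆ frontier D ∧
    (∀ t ∈ Ioo a b, IsToTheLeft D γ t) ∧
    ((x = γ a ∧ κ = signedCurvature γ a) ∨ (x = γ b ∧ κ = signedCurvature γ b))

/-- The set of the projections of `r` onto `E`, i.e., of the minimizers of the distance. -/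
def projections (r : Plane) (E : Set Plane) : Set Plane :=
  {p | p ∈ E ∧ ∀ q ∈ E, dist r p ≤ dist r q}

/-- On the parameter interval `(a, b)`, the map `γ` traces a smooth piece, without end-points, of
the boundary of `D`; smoothness means `C^k` regularity (`k = ω` for analyticity). -/
def IsSmoothBoundaryPiece (k : WithTop ℕ∞) (D : Set Plane) (γ : ℝ → Plane) (a b : ℝ) : Prop :=
  ContDiffOn ℝ k γ (Ioo a b) ∧ (∀ t ∈ Ioo a b, deriv γ t ≠ 0) ∧ InjOn γ (Ioo a b) ∧
    γ '' Ioo a b ⊆ frontier D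

variable {N : ℕ}

/-- The segment `[p, q]` is a bridge of the scene with the objects `D i`: it meets the union of the
objects exactly at its end-points, and whenever an end-point lies inside a smooth piece of the
boundary of an extended object, the segment is normal to this boundary there. -/
def IsBridge (k : WithTop ℕ∞) (D : Fin N → Set Plane) (p q : Plane) : Prop :=
  segment ℝ p q ∩ (⋃ i, D i) = {p, q} ∧
    ∀ i, IsExtendedObject (D i) → ∀ (γ : ℝ → Plane) (a b : ℝ),
      IsSmoothBoundaryPiece k (D i) γ a b → ∀ t ∈ Ioo a b, (γ t = p ∨ γ t = q) →
        inner ℝ (q - p) (deriv γ t) = 0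

/-- The distance `d > 0` is bizarre for the scene with the objects `D i`. -/
def IsBizarre (k : WithTop ℕ∞) (D : Fin N → Set Plane) (d : ℝ) : Prop :=
  0 < d ∧
    ((∃ i, IsExtendedObject (D i) ∧
        {x ∈ frontier (D i) | HasOneSidedCurvature (D i) x (-d⁻¹)}.Infinite) ∨
      {r | r ∉ (⋃ i, D i) ∧ Metric.infDist r (⋃ i, D i) = d ∧
        ¬ ∃ p, projections r (⋃ i, D i) = {p}}.Infinite ∨
      ∃ p q, IsBridge k D p q ∧ dist p q = 2 * d)

end PlanarScene

end

/-!
The boundaries of the objects form a *network*: finitely many regular analytic arcs that are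
disjoint except for common end-points, which belong to a finite set of vertices
(`exists_isArcNetwork_of_scene`). The three kinds of bizarre numbers are treated as follows.

* Curvature. The curvature of an arc is, up to sign, independent of the parametrization
  (`abs_signedCurvature_eq`). By the identity theorem, its absolute value is constant on an arc if it
  takes a nonzero value infinitely often; thus each arc contributes at most one number
  (`IsArcNetwork.finite_curvature_radii`).

* Bridges. A bridge joins two points of the network and is normal to it at each end-point other than
  a vertex. Such lengths are finite in number by compactness, as they are locally constant
  (`IsArcNetwork.finite_doubleNormal_lengths`). For two arcs `α`, `β`, a normal segment is a critical
  point of `F (s, t) = ‖α s - β t‖ ^ 2`. Since the plane is two-dimensional, the tangents at the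
  end-points of the segment are parallel, hence `∂²F / ∂s∂t = -2 ⟪α', β'⟫ ≠ 0`. Therefore the
  equation `∂F / ∂s = 0` can be solved for `t` analytically, and the critical values of `F` become
  those of an analytic function of one variable (`doubleNormal_locally_constant`). This also covers
  the base points with `α s = β t`, near which there are no segments of nonzero length.

* Several nearest points. Infinitely many such points `r k` at the distance `d` accumulate at some
  `x`, and two different nearest points of `r k` tend to nearest points `y`, `z` of `x`. Comparing
  distances shows that the limit direction of `r k - x` is orthogonal to both `x - y` and `x - z`.
  In the plane, this leaves two possibilities. Either `x` is the midpoint of `y` and `z`; then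
  `[y, z]` is of length `2 * d` and normal to the network at both end-points, so `d` is again one of
  finitely many numbers. Or `y = z`; this is excluded (`IsArcNetwork.false_of_collapse`). Indeed,
  `r k` runs along the offset curve of an arc issuing from `y`. The disk of radius `d` centered at
  `x` contains no points of the arc, so by analyticity the offset curve either is constant or goes in
  the same direction as the arc (`offset_const_or_strictMonoOn`). Thus neither two points of one arc
  nor points of two arcs with opposite directions can be nearest to the same `r k`. For two arcs that
  form a cusp, one of them lies above the other as seen from `x`, and the lower one contains no
  nearest points (`IsNearestSeq.false_of_cusp`).
-/

noncomputable section

namespace PlanarScene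

/-! ### Linear algebra in the plane -/

theorem inner_eq_coord (v w : Plane) : inner ℝ v w = v 0 * w 0 + v 1 * w 1 := by
  simp [PiLp.inner_apply, Fin.sum_univ_two]; ring

theorem norm_sq_eq_coord (v : Plane) : ‖v‖ ^ 2 = v 0 ^ 2 + v 1 ^ 2 := by
  rw [← real_inner_self_eq_norm_sq, inner_eq_coord]; ring

@[simp] theorem rotLeft_apply_zero (v : Plane) : rotLeft v 0 = -v 1 := rfl

@[simp] theorem rotLeft_apply_one (v : Plane) : rotLeft v 1 = v 0 := rfl

theorem norm_rotLeft (v : Plane) : ‖rotLeft v‖ = ‖v‖ := by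
  rw [← sq_eq_sq₀ (norm_nonneg _) (norm_nonneg _), norm_sq_eq_coord, norm_sq_eq_coord]
  simp; ring

theorem inner_rotLeft_self (v : Plane) : inner ℝ (rotLeft v) v = 0 := by
  rw [inner_eq_coord]; simp; ring

theorem plane_ext {v w : Plane} (h0 : v 0 = w 0) (h1 : v 1 = w 1) : v = w := by
  ext i; fin_cases i <;> assumption

theorem coord_sq_add_pos {v : Plane} (hv : v ≠ 0) : 0 < v 0 ^ 2 + v 1 ^ 2 := by
  rw [← norm_sq_eq_coord]; exact pow_pos (norm_pos_iff.2 hv) 2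

/-- A vector of the plane is determined by its products with two orthogonal vectors `v` and
`rotLeft v`. -/
theorem eq_of_inner_eq {v x y : Plane} (hv : v ≠ 0) (h : inner ℝ x v = inner ℝ y v)
    (h' : inner ℝ x (rotLeft v) = inner ℝ y (rotLeft v)) : x = y := by
  rw [inner_eq_coord, inner_eq_coord] at h h'
  simp only [rotLeft_apply_zero, rotLeft_apply_one] at h'
  have hp := (coord_sq_add_pos hv).ne'
  refine plane_ext ?_ ?_ <;> refine mul_right_cancel₀ hp ?_
  · linear_combination v 0 * h - v 1 * h'
  · linear_combination v 1 * h + v 0 * h'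

/-- The vectors orthogonal to `v ≠ 0` are the multiples of `rotLeft v`. -/
theorem eq_smul_rotLeft {v x : Plane} (hv : v ≠ 0) (h : inner ℝ x v = 0) :
    x = (inner ℝ x (rotLeft v) / ‖v‖ ^ 2) • rotLeft v := by
  have hn : ‖v‖ ^ 2 ≠ 0 := (pow_pos (norm_pos_iff.2 hv) 2).ne'
  apply eq_of_inner_eq hv
  · rw [h, real_inner_smul_left, inner_rotLeft_self, mul_zero]
  · rw [real_inner_smul_left, real_inner_self_eq_norm_sq, norm_rotLeft]; field_simp

/-- The vectors orthogonal to `rotLeft v` are the multiples of `v`. -/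
theorem eq_smul_of_inner_rotLeft {v x : Plane} (hv : v ≠ 0) (h : inner ℝ x (rotLeft v) = 0) :
    x = (inner ℝ x v / ‖v‖ ^ 2) • v := by
  have hn : ‖v‖ ^ 2 ≠ 0 := (pow_pos (norm_pos_iff.2 hv) 2).ne'
  apply eq_of_inner_eq hv
  · rw [real_inner_smul_left, real_inner_self_eq_norm_sq]; field_simp
  · rw [h, real_inner_smul_left, real_inner_comm _ v, inner_rotLeft_self, mul_zero]

/-- Two vectors orthogonal to the same `v ≠ 0` and of the same length differ at most by sign. -/
theorem eq_or_eq_neg_of_inner_eq_zero {v x y : Plane} (hv : v ≠ 0) (hx : inner ℝ x v = 0)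
    (hy : inner ℝ y v = 0) (h : ‖x‖ = ‖y‖) : x = y ∨ x = -y := by
  have hr : ‖rotLeft v‖ ≠ 0 := by rw [norm_rotLeft]; exact norm_ne_zero_iff.2 hv
  have ex := eq_smul_rotLeft hv hx
  have ey := eq_smul_rotLeft hv hy
  set a := inner ℝ x (rotLeft v) / ‖v‖ ^ 2
  set b := inner ℝ y (rotLeft v) / ‖v‖ ^ 2
  rw [ex, ey, norm_smul, norm_smul] at h
  have hab : |a| = |b| := mul_right_cancel₀ hr h
  rcases abs_eq_abs.1 hab with h | h
  · left; rw [ex, ey, h]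
  · right; rw [ex, ey, h, neg_smul]

/-- If a nonzero vector is orthogonal to both `v` and `w`, then `v` and `w` are parallel. -/
theorem inner_rotLeft_eq_zero_of_orthogonal {x v w : Plane} (hx : x ≠ 0) (hv : inner ℝ x v = 0)
    (hw : inner ℝ x w = 0) : inner ℝ (rotLeft v) w = 0 := by
  rw [inner_eq_coord] at *
  simp only [rotLeft_apply_zero, rotLeft_apply_one]
  refine mul_right_cancel₀ (coord_sq_add_pos hx).ne' ?_
  linear_combination (x 0 * w 1 - x 1 * w 0) * hv + (x 1 * v 0 - x 0 * v 1) * hw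

theorem inner_ne_zero_of_parallel {v w : Plane} (hv : v ≠ 0) (hw : w ≠ 0)
    (h : inner ℝ (rotLeft v) w = 0) : inner ℝ v w ≠ 0 := by
  intro h0
  apply hw
  apply eq_of_inner_eq hv
  · rw [real_inner_comm, h0, inner_zero_left]
  · rw [real_inner_comm, h, inner_zero_left]

/-! ### Analytic curves -/

section Analytic
variable {α : ℝ → Plane} {s : ℝ}

theorem analyticAt_coord {E : Type*} [NormedAddCommGroup E] [NormedSpace ℝ E] {f : E → Plane}
    {z : E} (h : AnalyticAt ℝ f z) (i : Fin 2) : AnalyticAt ℝ (fun u => f u i) z :=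
  ((EuclideanSpace.proj i : Plane →L[ℝ] ℝ).analyticAt (f z)).comp h

theorem analyticAt_inner {E : Type*} [NormedAddCommGroup E] [NormedSpace ℝ E] {f g : E → Plane}
    {z : E} (h : AnalyticAt ℝ f z) (h' : AnalyticAt ℝ g z) :
    AnalyticAt ℝ (fun u => inner ℝ (f u) (g u)) z := by
  simp only [inner_eq_coord]
  exact ((analyticAt_coord h 0).mul (analyticAt_coord h' 0)).add
    ((analyticAt_coord h 1).mul (analyticAt_coord h' 1))

theorem analyticAt_rotLeft {E : Type*} [NormedAddCommGroup E] [NormedSpace ℝ E] {f : E → Plane}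
    {z : E} (h : AnalyticAt ℝ f z) : AnalyticAt ℝ (fun u => rotLeft (f u)) z := by
  have e : (fun u => rotLeft (f u)) =
      fun u => (-f u 1) • (!₂[1, 0] : Plane) + (f u 0) • (!₂[0, 1] : Plane) := by
    funext u; apply plane_ext <;> simp
  rw [e]
  exact ((analyticAt_coord h 1).neg.smul analyticAt_const).add
    ((analyticAt_coord h 0).smul analyticAt_const)

theorem analyticAt_norm (h : AnalyticAt ℝ α s) (h0 : α s ≠ 0) :
    AnalyticAt ℝ (fun u => ‖α u‖) s :=
  (h.contDiffAt.norm ℝ h0 (n := ⊤)).analyticAt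

theorem eventually_deriv_ne_zero (h : AnalyticAt ℝ α s) (h0 : deriv α s ≠ 0) :
    ∀ᶠ u in 𝓝 s, deriv α u ≠ 0 :=
  h.deriv.continuousAt.eventually_ne h0

theorem hasDerivAt_inner_const (h : AnalyticAt ℝ α s) (v : Plane) :
    HasDerivAt (fun u => inner ℝ (α u) v) (inner ℝ (deriv α s) v) s := by
  simpa using h.differentiableAt.hasDerivAt.inner ℝ (hasDerivAt_const s v)

theorem hasDerivAt_norm_sq (h : AnalyticAt ℝ α s) (x : Plane) :
    HasDerivAt (fun u => ‖α u - x‖ ^ 2) (2 * inner ℝ (α s - x) (deriv α s)) s := by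
  simpa using (h.differentiableAt.hasDerivAt.sub_const x).norm_sq

/-- A function analytic at a point either vanishes to the right of it, or has a constant sign
there. -/
theorem eventually_sign_right {f : ℝ → ℝ} (h : AnalyticAt ℝ f s) :
    (∀ᶠ u in 𝓝 s, f u = 0) ∨ (∀ᶠ u in 𝓝[>] s, 0 < f u) ∨ ∀ᶠ u in 𝓝[>] s, f u < 0 := by
  rcases h.eventually_eq_zero_or_eventually_ne_zero with h0 | h0
  · exact Or.inl h0
  right
  have h1 : ∀ᶠ u in 𝓝[>] s, f u ≠ 0 := h0.filter_mono (nhdsWithin_mono _ fun x hx => ne_of_gt hx)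
  have h2 : ∀ᶠ u in 𝓝[>] s, AnalyticAt ℝ f u :=
    h.eventually_analyticAt.filter_mono nhdsWithin_le_nhds
  obtain ⟨e, he, H⟩ := (mem_nhdsGT_iff_exists_Ioo_subset).1 (h1.and h2)
  have hc : ContinuousOn f (Ioo s e) := fun x hx => (H hx).2.continuousAt.continuousWithinAt
  have hm : Ioo s e ∈ 𝓝[>] s := Ioo_mem_nhdsGT he
  by_cases hp : ∃ x ∈ Ioo s e, 0 < f x
  · left
    obtain ⟨x, hx, hfx⟩ := hp
    filter_upwards [hm] with y hy
    by_contra hn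
    obtain ⟨z, hz, hz0⟩ := isPreconnected_Ioo.intermediate_value hy hx hc ⟨not_lt.1 hn, hfx.le⟩
    exact (H hz).1 hz0
  · right
    filter_upwards [hm] with y hy
    push Not at hp
    exact lt_of_le_of_ne (hp y hy) (H hy).1

end Analytic

/-! ### Lengths of double normals -/

theorem isInvertible_of_apply_one_ne_zero {f : ℝ →L[ℝ] ℝ} (h : f 1 ≠ 0) : f.IsInvertible := by
  refine ⟨ContinuousLinearEquiv.smulLeft (Units.mk0 (f 1) h), ?_⟩
  ext
  simp [Units.smul_def]

/-- Locally, all the segments of nonzero length that are normal to both of two regular analytic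
curves have the same length. If the tangents at the base points are not orthogonal, then the
condition of normality to `α` defines, by the implicit function theorem, `t` as an analytic function
of `s`, and the squared distance becomes an analytic function of the single variable `s`. -/
theorem doubleNormal_locally_constant {α β : ℝ → Plane} {s t : ℝ} (hα : AnalyticAt ℝ α s)
    (hβ : AnalyticAt ℝ β t) (hα' : deriv α s ≠ 0) (hβ' : deriv β t ≠ 0) :
    ∃ v : ℝ, ∀ᶠ z : ℝ × ℝ in 𝓝 (s, t), α z.1 ≠ β z.2 →
      inner ℝ (α z.1 - β z.2) (deriv α z.1) = 0 → inner ℝ (α z.1 - β z.2) (deriv β z.2) = 0 →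
      dist (α z.1) (β z.2) = v := by
  have hα1 : AnalyticAt ℝ (fun z : ℝ × ℝ => α z.1) (s, t) :=
    AnalyticAt.comp (f := Prod.fst) (x := (s, t)) hα analyticAt_fst
  have hα2 : AnalyticAt ℝ (fun z : ℝ × ℝ => deriv α z.1) (s, t) :=
    AnalyticAt.comp (g := deriv α) (f := Prod.fst) (x := (s, t)) hα.deriv analyticAt_fst
  have hβ1 : AnalyticAt ℝ (fun z : ℝ × ℝ => β z.2) (s, t) :=
    AnalyticAt.comp (f := Prod.snd) (x := (s, t)) hβ analyticAt_snd
  have hβ2 : AnalyticAt ℝ (fun z : ℝ × ℝ => deriv β z.2) (s, t) :=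
    AnalyticAt.comp (g := deriv β) (f := Prod.snd) (x := (s, t)) hβ.deriv analyticAt_snd
  by_cases hpar : inner ℝ (rotLeft (deriv α s)) (deriv β t) = 0
  swap
  · -- Transversal tangents: the normals to the two curves are not parallel either.
    refine ⟨0, ?_⟩
    have hc :
        ContinuousAt (fun z : ℝ × ℝ => inner ℝ (rotLeft (deriv α z.1)) (deriv β z.2)) (s, t) :=
      (analyticAt_inner (analyticAt_rotLeft hα2) hβ2).continuousAt
    filter_upwards [hc.eventually_ne hpar] with z hz hne h1 h2
    exact absurd (inner_rotLeft_eq_zero_of_orthogonal (sub_ne_zero.2 hne) h1 h2) hz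
  have hne : inner ℝ (deriv α s) (deriv β t) ≠ 0 := inner_ne_zero_of_parallel hα' hβ' hpar
  set ψ : ℝ × ℝ → ℝ := fun z => inner ℝ (α z.1 - β z.2) (deriv α z.1) with hψdef
  have hψ : AnalyticAt ℝ ψ (s, t) := analyticAt_inner (hα1.sub hβ1) hα2
  by_cases h0 : ψ (s, t) = 0
  swap
  · refine ⟨0, ?_⟩
    filter_upwards [hψ.continuousAt.eventually_ne h0] with z hz _ h1
    exact absurd h1 hz
  have hcd : ContDiffAt ℝ ⊤ ψ (s, t) := hψ.contDiffAt
  have hinv : (fderiv ℝ ψ (s, t) ∘L .inr ℝ ℝ ℝ).IsInvertible := by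
    apply isInvertible_of_apply_one_ne_zero
    have h1 : HasDerivAt (fun u : ℝ => ψ (s, u)) (fderiv ℝ ψ (s, t) (0, 1)) t :=
      HasFDerivAt.comp_hasDerivAt (f := fun u : ℝ => (s, u)) t
        hψ.differentiableAt.hasFDerivAt ((hasDerivAt_const t s).prodMk (hasDerivAt_id t))
    have h2 : HasDerivAt (fun u : ℝ => ψ (s, u)) (inner ℝ (-deriv β t) (deriv α s)) t := by
      simpa [ψ] using
        (hβ.differentiableAt.hasDerivAt.const_sub (α s)).inner ℝ (hasDerivAt_const t (deriv α s))
    have h3 := h1.unique h2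
    simp only [ContinuousLinearMap.comp_apply, ContinuousLinearMap.inr_apply, h3, inner_neg_left]
    rw [real_inner_comm]
    exact neg_ne_zero.2 hne
  have htop : (⊤ : WithTop ℕ∞) ≠ 0 := by simp
  set τ := hcd.implicitFunction htop hinv with hτ
  have hτs : τ s = t := hcd.implicitFunction_apply_self htop hinv
  have hτa : AnalyticAt ℝ τ s := (hcd.contDiffAt_implicitFunction htop hinv).analyticAt
  have hτ0 : ∀ᶠ u in 𝓝 s, ψ (u, τ u) = 0 := by
    have := hcd.eventually_apply_implicitFunction htop hinv
    simpa only [h0] using this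
  have hτiff : ∀ᶠ z in 𝓝 (s, t), ψ z = 0 ↔ τ z.1 = z.2 := by
    have := hcd.eventually_apply_eq_iff_implicitFunction htop hinv
    simpa only [h0] using this
  have hβτ : AnalyticAt ℝ (fun u => β (τ u)) s :=
    AnalyticAt.comp (g := β) (by rw [hτs]; exact hβ) hτa
  have hβτ' : AnalyticAt ℝ (fun u => deriv β (τ u)) s :=
    AnalyticAt.comp (g := deriv β) (by rw [hτs]; exact hβ.deriv) hτa
  have hχ : AnalyticAt ℝ (fun u => inner ℝ (α u - β (τ u)) (deriv β (τ u))) s :=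
    analyticAt_inner (hα.sub hβτ) hβτ'
  refine ⟨dist (α s) (β t), ?_⟩
  rcases hχ.eventually_eq_zero_or_eventually_ne_zero with hz | hz
  · -- The squared distance along `t = τ s` has zero derivative.
    have hd : ∀ᶠ u in 𝓝 s, HasDerivAt (fun u => ‖α u - β (τ u)‖ ^ 2) 0 u := by
      have hτβ : ∀ᶠ u in 𝓝 s, AnalyticAt ℝ β (τ u) := by
        have : Tendsto τ (𝓝 s) (𝓝 t) := by
          simpa [hτs] using hτa.continuousAt.tendsto
        exact this.eventually hβ.eventually_analyticAt
      filter_upwards [hz, hτ0, hα.eventually_analyticAt, hτa.eventually_analyticAt, hτβ]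
        with u h1 h2 h3 h4 h5
      have h6 := (h3.differentiableAt.hasDerivAt.sub (HasDerivAt.scomp u
        h5.differentiableAt.hasDerivAt h4.differentiableAt.hasDerivAt)).norm_sq
      have h7 : inner ℝ ((α - β ∘ τ) u) (deriv α u - deriv τ u • deriv β (τ u)) = 0 := by
        rw [inner_sub_right, inner_smul_right]
        change inner ℝ (α u - β (τ u)) _ - _ * inner ℝ (α u - β (τ u)) _ = 0
        rw [h1, mul_zero, sub_zero]
        exact h2
      rw [h7, mul_zero] at h6
      exact h6
    obtain ⟨ε, hε, hball⟩ := Metric.eventually_nhds_iff_ball.1 hd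
    have hconst : ∀ u ∈ Metric.ball s ε, ‖α u - β (τ u)‖ ^ 2 = ‖α s - β t‖ ^ 2 := by
      intro u hu
      have := Metric.isOpen_ball.is_const_of_deriv_eq_zero (convex_ball s ε).isPreconnected
        (fun x hx => (hball x hx).differentiableAt.differentiableWithinAt)
        (fun x hx => (hball x hx).deriv) hu (Metric.mem_ball_self hε)
      simpa [hτs] using this
    have hfst : Tendsto Prod.fst (𝓝 (s, t)) (𝓝 s) := continuousAt_fst
    filter_upwards [hτiff, hfst.eventually (Metric.ball_mem_nhds s hε)] with z h1 h2 _ h3 _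
    have h4 := hconst z.1 h2
    rw [h1.1 h3] at h4
    rw [dist_eq_norm, dist_eq_norm]
    exact (sq_eq_sq₀ (norm_nonneg _) (norm_nonneg _)).1 h4
  · have hz' : ∀ᶠ u in 𝓝 s, u ≠ s → inner ℝ (α u - β (τ u)) (deriv β (τ u)) ≠ 0 :=
      eventually_nhdsWithin_iff.1 hz
    have hfst : Tendsto Prod.fst (𝓝 (s, t)) (𝓝 s) := continuousAt_fst
    filter_upwards [hτiff, hfst.eventually hz'] with z h1 h2 _ h3 h4
    have h5 := h1.1 h3
    rw [h5] at h2
    have h6 : z.1 = s := by_contra fun h => h2 h h4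
    have h7 : z.2 = t := by rw [← h5, h6, hτs]
    rw [h6, h7]

/-- Locally, all the segments from a point `x` that are normal to a regular analytic curve have the
same length. -/
theorem normal_locally_constant {α : ℝ → Plane} {s : ℝ} (hα : AnalyticAt ℝ α s) (x : Plane) :
    ∃ v : ℝ, ∀ᶠ u in 𝓝 s, inner ℝ (α u - x) (deriv α u) = 0 → dist (α u) x = v := by
  have hχ : AnalyticAt ℝ (fun u => inner ℝ (α u - x) (deriv α u)) s :=
    analyticAt_inner (hα.sub analyticAt_const) hα.deriv
  refine ⟨dist (α s) x, ?_⟩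
  rcases hχ.eventually_eq_zero_or_eventually_ne_zero with hz | hz
  · obtain ⟨ε, hε, hball⟩ := Metric.eventually_nhds_iff_ball.1 (hz.and hα.eventually_analyticAt)
    have hd : ∀ u ∈ Metric.ball s ε, HasDerivAt (fun u => ‖α u - x‖ ^ 2) 0 u := fun u hu => by
      simpa [(hball u hu).1] using hasDerivAt_norm_sq (hball u hu).2 x
    filter_upwards [Metric.ball_mem_nhds s hε] with u hu _
    have := Metric.isOpen_ball.is_const_of_deriv_eq_zero (convex_ball s ε).isPreconnected
      (fun y hy => (hd y hy).differentiableAt.differentiableWithinAt)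
      (fun y hy => (hd y hy).deriv) hu (Metric.mem_ball_self hε)
    rw [dist_eq_norm, dist_eq_norm]
    exact (sq_eq_sq₀ (norm_nonneg _) (norm_nonneg _)).1 this
  · filter_upwards [eventually_nhdsWithin_iff.1 hz] with u h1 h2
    have h3 : u = s := by_contra fun h => h1 h h2
    rw [h3]

/-! ### Networks of arcs -/

/-- The arcs `c j`, parametrized by `[0, 1]`, are regular analytic, have their end-points in the
finite set `V` of vertices, and are otherwise disjoint from `V`, from each other and free of
self-intersections. Some of the vertices may be isolated. -/
structure IsArcNetwork {ι : Type*} (V : Set Plane) (c : ι → ℝ → Plane) : Prop where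
  finite_vertices : V.Finite
  regular : ∀ j, IsRegularAnalyticSegment (c j) 0 1
  left_mem : ∀ j, c j 0 ∈ V
  right_mem : ∀ j, c j 1 ∈ V
  notMem : ∀ j, ∀ t ∈ Ioo (0 : ℝ) 1, c j t ∉ V
  inj : ∀ i j, ∀ s ∈ Ioo (0 : ℝ) 1, ∀ t ∈ Ioo (0 : ℝ) 1, c i s = c j t → i = j ∧ s = t

/-- The set of the points of a network of arcs. -/
def arcSupport {ι : Type*} (V : Set Plane) (c : ι → ℝ → Plane) : Set Plane :=
  V ∪ ⋃ j, c j '' Ioo (0 : ℝ) 1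

/-- The point `p` of a network is a vertex, or `w` is normal to the network at `p`. -/
def IsNormalAt {ι : Type*} (V : Set Plane) (c : ι → ℝ → Plane) (p w : Plane) : Prop :=
  p ∈ V ∨ ∃ j, ∃ t ∈ Ioo (0 : ℝ) 1, c j t = p ∧ inner ℝ w (deriv (c j) t) = 0

section Network
variable {ι : Type*} {V : Set Plane} {c : ι → ℝ → Plane}

theorem mem_arcSupport {x : Plane} :
    x ∈ arcSupport V c ↔ x ∈ V ∨ ∃ j, ∃ t ∈ Ioo (0 : ℝ) 1, c j t = x := by
  simp [arcSupport]

theorem IsArcNetwork.analyticAt (h : IsArcNetwork V c) (j : ι) {t : ℝ} (ht : t ∈ Icc (0 : ℝ) 1) :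
    AnalyticAt ℝ (c j) t := (h.regular j).2.1 t ht

theorem IsArcNetwork.deriv_ne_zero (h : IsArcNetwork V c) (j : ι) {t : ℝ}
    (ht : t ∈ Icc (0 : ℝ) 1) : deriv (c j) t ≠ 0 := (h.regular j).2.2 t ht

theorem IsArcNetwork.continuousOn (h : IsArcNetwork V c) (j : ι) :
    ContinuousOn (c j) (Icc (0 : ℝ) 1) :=
  fun _ ht => (h.analyticAt j ht).continuousAt.continuousWithinAt

theorem IsArcNetwork.mem_arcSupport_of_mem_Icc (h : IsArcNetwork V c) (j : ι) {t : ℝ}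
    (ht : t ∈ Icc (0 : ℝ) 1) : c j t ∈ arcSupport V c := by
  rw [mem_arcSupport]
  rcases eq_endpoints_or_mem_Ioo_of_mem_Icc ht with rfl | rfl | ht'
  · exact Or.inl (h.left_mem j)
  · exact Or.inl (h.right_mem j)
  · exact Or.inr ⟨j, t, ht', rfl⟩

theorem IsArcNetwork.arcSupport_eq (h : IsArcNetwork V c) :
    arcSupport V c = V ∪ ⋃ j, c j '' Icc (0 : ℝ) 1 := by
  apply Subset.antisymm
  · exact union_subset_union_right _ (iUnion_mono fun j => image_mono Ioo_subset_Icc_self)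
  · refine union_subset subset_union_left (iUnion_subset fun j => ?_)
    rintro _ ⟨t, ht, rfl⟩
    exact h.mem_arcSupport_of_mem_Icc j ht

theorem IsArcNetwork.isCompact_arcSupport [Finite ι] (h : IsArcNetwork V c) :
    IsCompact (arcSupport V c) := by
  rw [h.arcSupport_eq]
  exact h.finite_vertices.isCompact.union
    (isCompact_iUnion fun j => isCompact_Icc.image_of_continuousOn (h.continuousOn j))

/-- A function takes only finitely many values at the points of a compact set with the property `Q`
if every point of the compact set, with or without this property, has a neighborhood in which all
the points with the property have the same value. -/
theorem finite_image_of_locally_constant {X Y : Type*} [TopologicalSpace X] {K : Set X}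
    (hK : IsCompact K) {Q : X → Prop} {f : X → Y}
    (h : ∀ x ∈ K, ∃ v, ∀ᶠ z in 𝓝 x, Q z → f z = v) : (f '' {z ∈ K | Q z}).Finite := by
  suffices H : (f '' (K ∩ {z | Q z})).Finite from H
  refine hK.induction_on (p := fun s => (f '' (s ∩ {z | Q z})).Finite) (by simp) ?_ ?_ ?_
  · exact fun s t hst ht => ht.subset (image_mono (inter_subset_inter_left _ hst))
  · intro s t hs ht
    rw [union_inter_distrib_right, image_union]
    exact hs.union ht
  · intro x hx
    obtain ⟨v, hv⟩ := h x hx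
    refine ⟨_, mem_nhdsWithin_of_mem_nhds hv, (finite_singleton v).subset ?_⟩
    rintro _ ⟨z, ⟨hz, hQ⟩, rfl⟩
    exact hz hQ

/-- The segments of nonzero length that join two points of a network and are normal to it at both
end-points have finitely many lengths. -/
theorem IsArcNetwork.finite_doubleNormal_lengths [Finite ι] (h : IsArcNetwork V c) :
    {l : ℝ | ∃ p q, p ≠ q ∧ IsNormalAt V c p (q - p) ∧ IsNormalAt V c q (q - p) ∧
      dist p q = l}.Finite := by
  have hVV : (image2 dist V V).Finite := h.finite_vertices.image2 _ h.finite_vertices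
  have hVA : (⋃ v ∈ V, ⋃ j, (fun t => dist (c j t) v) ''
      {t ∈ Icc (0 : ℝ) 1 | inner ℝ (c j t - v) (deriv (c j) t) = 0}).Finite :=
    h.finite_vertices.biUnion fun v _ => finite_iUnion fun j =>
      finite_image_of_locally_constant isCompact_Icc fun t ht =>
        normal_locally_constant (h.analyticAt j ht) v
  have hAA : (⋃ i, ⋃ j, (fun z : ℝ × ℝ => dist (c i z.1) (c j z.2)) ''
      {z ∈ Icc (0 : ℝ) 1 ×ˢ Icc (0 : ℝ) 1 | c i z.1 ≠ c j z.2 ∧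
        inner ℝ (c i z.1 - c j z.2) (deriv (c i) z.1) = 0 ∧
        inner ℝ (c i z.1 - c j z.2) (deriv (c j) z.2) = 0}).Finite := by
    refine finite_iUnion fun i => finite_iUnion fun j =>
      finite_image_of_locally_constant (isCompact_Icc.prod isCompact_Icc) ?_
    rintro ⟨s, t⟩ ⟨hs, ht⟩
    obtain ⟨v, hv⟩ := doubleNormal_locally_constant (h.analyticAt i hs) (h.analyticAt j ht)
      (h.deriv_ne_zero i hs) (h.deriv_ne_zero j ht)
    exact ⟨v, hv.mono fun z hz hQ => hz hQ.1 hQ.2.1 hQ.2.2⟩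
  refine ((hVV.union hVA).union hAA).subset ?_
  rintro l ⟨p, q, hne, hp | ⟨i, s, hs, rfl, hs'⟩, hq | ⟨j, t, ht, rfl, ht'⟩, rfl⟩
  · exact Or.inl (Or.inl ⟨p, hp, q, hq, rfl⟩)
  · refine Or.inl (Or.inr ?_)
    simp only [mem_iUnion]
    exact ⟨p, hp, j, t, ⟨Ioo_subset_Icc_self ht, ht'⟩, dist_comm _ _⟩
  · refine Or.inl (Or.inr ?_)
    simp only [mem_iUnion]
    refine ⟨q, hq, i, s, ⟨Ioo_subset_Icc_self hs, ?_⟩, rfl⟩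
    rw [← neg_sub, inner_neg_left, hs', neg_zero]
  · refine Or.inr ?_
    simp only [mem_iUnion]
    refine ⟨i, j, (s, t), ⟨⟨Ioo_subset_Icc_self hs, Ioo_subset_Icc_self ht⟩, hne, ?_, ?_⟩, rfl⟩
    · rw [← neg_sub, inner_neg_left, hs', neg_zero]
    · rw [← neg_sub, inner_neg_left, ht', neg_zero]

end Network

/-! ### Points of given curvature -/

/-- Near a common point of `α` and a regular analytic curve `β`, the curve `α` is projected to `β`
in the direction normal to `β` at this point: `φ s` is the parameter of the projection of `α s`. -/
theorem exists_normal_projection {α β : ℝ → Plane} {a b : ℝ} (hα : AnalyticAt ℝ α a)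
    (hβ : AnalyticAt ℝ β b) (hβ' : deriv β b ≠ 0) (hab : α a = β b) :
    ∃ φ : ℝ → ℝ, AnalyticAt ℝ φ a ∧ φ a = b ∧
      (∀ᶠ t in 𝓝 b, ∀ s, α s = β t → φ s = t) ∧
      ∀ᶠ s in 𝓝 a, inner ℝ (β (φ s)) (deriv β b) = inner ℝ (α s) (deriv β b) := by
  set v := deriv β b with hv
  have hg : AnalyticAt ℝ (fun t => inner ℝ (β t) v) b := analyticAt_inner hβ analyticAt_const
  have hg' : deriv (fun t => inner ℝ (β t) v) b ≠ 0 := by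
    rw [(hasDerivAt_inner_const hβ v).deriv, ← hv]
    exact inner_self_ne_zero.2 hβ'
  have hf : AnalyticAt ℝ (fun s => inner ℝ (α s) v) a := analyticAt_inner hα analyticAt_const
  set ℓ := hg.hasStrictDerivAt.localInverse _ _ _ hg' with hℓ
  have hℓa : AnalyticAt ℝ ℓ (inner ℝ (β b) v) := hg.analyticAt_localInverse hg'
  have h1 : ∀ᶠ t in 𝓝 b, ℓ (inner ℝ (β t) v) = t := hg.hasStrictDerivAt.eventually_left_inverse hg'
  have h2 : ∀ᶠ y in 𝓝 (inner ℝ (β b) v), inner ℝ (β (ℓ y)) v = y :=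
    hg.hasStrictDerivAt.eventually_right_inverse hg'
  refine ⟨fun s => ℓ (inner ℝ (α s) v), ?_, ?_, ?_, ?_⟩
  · exact AnalyticAt.comp (g := ℓ) (by rw [hab]; exact hℓa) hf
  · simp only [hab]
    exact h1.self_of_nhds
  · filter_upwards [h1] with t ht s hs
    rw [hs, ht]
  · have : Tendsto (fun s => inner ℝ (α s) v) (𝓝 a) (𝓝 (inner ℝ (β b) v)) := by
      rw [← hab]; exact hf.continuousAt
    exact this.eventually h2

/-- If a regular analytic curve lies on another one near a common point, then their curvatures at
this point coincide up to sign. -/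
theorem abs_signedCurvature_eq {α β : ℝ → Plane} {a b : ℝ} (hα : AnalyticAt ℝ α a)
    (hα' : deriv α a ≠ 0) (hβ : AnalyticAt ℝ β b) (hβ' : deriv β b ≠ 0) (hab : α a = β b)
    (h : ∀ U ∈ 𝓝 b, ∃ᶠ s in 𝓝[≠] a, α s ∈ β '' U) :
    |signedCurvature α a| = |signedCurvature β b| := by
  obtain ⟨φ, hφ, hφa, hφ1, -⟩ := exists_normal_projection hα hβ hβ' hab
  have hβφ : AnalyticAt ℝ (β ∘ φ) a := AnalyticAt.comp (by rw [hφa]; exact hβ) hφ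
  have heq : α =ᶠ[𝓝 a] β ∘ φ := by
    refine (hα.frequently_eq_iff_eventually_eq hβφ).1 ((h _ hφ1).mono ?_)
    rintro s ⟨t, ht, hts⟩
    simp [ht s hts.symm, hts]
  have hd : deriv α =ᶠ[𝓝 a] fun s => deriv φ s • deriv β (φ s) := by
    refine heq.deriv.trans ?_
    have hφt : Tendsto φ (𝓝 a) (𝓝 b) := by simpa [hφa] using hφ.continuousAt.tendsto
    filter_upwards [hφ.eventually_analyticAt, hφt.eventually hβ.eventually_analyticAt] with s h1 h2
    exact (HasDerivAt.scomp s h2.differentiableAt.hasDerivAt h1.differentiableAt.hasDerivAt).deriv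
  have hd1 : deriv α a = deriv φ a • deriv β b := by simpa [hφa] using hd.self_of_nhds
  have hd2 : deriv (deriv α) a =
      deriv φ a • deriv φ a • deriv (deriv β) b + deriv (deriv φ) a • deriv β b := by
    rw [hd.deriv_eq]
    have h3 : HasDerivAt (fun s => deriv β (φ s)) (deriv φ a • deriv (deriv β) b) a := by
      have := HasDerivAt.scomp (g₁ := deriv β) a
        (by rw [hφa]; exact hβ.deriv.differentiableAt.hasDerivAt) hφ.differentiableAt.hasDerivAt
      exact this
    have h4 := (hφ.deriv.differentiableAt.hasDerivAt.smul h3).deriv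
    rw [hφa] at h4
    exact h4
  have hφ0 : deriv φ a ≠ 0 := by
    rintro h0
    rw [h0, zero_smul] at hd1
    exact hα' hd1
  have hnum : deriv α a 0 * deriv (deriv α) a 1 - deriv α a 1 * deriv (deriv α) a 0 =
      deriv φ a ^ 3 * (deriv β b 0 * deriv (deriv β) b 1 - deriv β b 1 * deriv (deriv β) b 0) := by
    rw [hd2, hd1]
    simp only [PiLp.add_apply, PiLp.smul_apply, smul_eq_mul]
    ring
  rw [signedCurvature, signedCurvature, hnum, hd1, norm_smul, Real.norm_eq_abs, mul_pow, abs_div,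
    abs_div, abs_mul, abs_mul, abs_pow, abs_pow, abs_abs, mul_div_mul_left]
  exact pow_ne_zero _ (abs_ne_zero.2 hφ0)

section Network
variable {ι : Type*} {V : Set Plane} {c : ι → ℝ → Plane}

/-- Near an interior point of an arc, a network consists of this arc only. -/
theorem IsArcNetwork.eventually_mem_image [Finite ι] (h : IsArcNetwork V c) (j : ι) {t : ℝ}
    (ht : t ∈ Ioo (0 : ℝ) 1) {U : Set ℝ} (hU : U ∈ 𝓝 t) :
    ∀ᶠ y in 𝓝 (c j t), y ∈ arcSupport V c → y ∈ c j '' U := by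
  obtain ⟨W, hWU, hW, htW⟩ := mem_nhds_iff.1 hU
  set K : Set Plane := V ∪ ⋃ i, c i '' (Icc (0 : ℝ) 1 ∩ {s | i = j → s ∉ W}) with hK
  have hKc : IsCompact K := by
    refine h.finite_vertices.isCompact.union (isCompact_iUnion fun i => ?_)
    have hcl : IsClosed {s : ℝ | i = j → s ∉ W} := by
      by_cases hij : i = j
      · exact (by simp [hij, Set.ext_iff] : {s : ℝ | i = j → s ∉ W} = Wᶜ) ▸ hW.isClosed_compl
      · simp [hij]
    exact (isCompact_Icc.inter_right hcl).image_of_continuousOn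
      ((h.continuousOn i).mono inter_subset_left)
  have hx : c j t ∉ K := by
    rintro (hV | hi)
    · exact h.notMem j t ht hV
    · simp only [mem_iUnion] at hi
      obtain ⟨i, s, ⟨hs, hsW⟩, hst⟩ := hi
      rcases eq_endpoints_or_mem_Ioo_of_mem_Icc hs with rfl | rfl | hs'
      · exact h.notMem j t ht (hst ▸ h.left_mem i)
      · exact h.notMem j t ht (hst ▸ h.right_mem i)
      · obtain ⟨hij, rfl⟩ := h.inj i j s hs' t ht hst
        exact hsW hij htW
  filter_upwards [hKc.isClosed.isOpen_compl.mem_nhds hx] with y hyK hy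
  rw [h.arcSupport_eq] at hy
  rcases hy with hV | hi
  · exact absurd (Or.inl hV) hyK
  · simp only [mem_iUnion] at hi
    obtain ⟨i, s, hs, rfl⟩ := hi
    by_contra hn
    refine hyK (Or.inr (mem_iUnion.2 ⟨i, s, ⟨hs, ?_⟩, rfl⟩))
    rintro rfl hsW
    exact hn ⟨s, hWU hsW, rfl⟩

/-- A regular analytic segment that lies on a network has, at each of its end-points other than a
vertex, the same curvature up to sign as the arc of the network. -/
theorem IsArcNetwork.exists_abs_signedCurvature_eq [Finite ι] (h : IsArcNetwork V c)
    {γ : ℝ → Plane} {a b s : ℝ} (hγ : IsRegularAnalyticSegment γ a b)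
    (hsub : γ '' Icc a b ⊆ arcSupport V c) (hs : s = a ∨ s = b) (hV : γ s ∉ V) :
    ∃ j, ∃ t ∈ Ioo (0 : ℝ) 1, c j t = γ s ∧ |signedCurvature (c j) t| = |signedCurvature γ s| := by
  have hsI : s ∈ Icc a b := by
    rcases hs with rfl | rfl
    · exact left_mem_Icc.2 hγ.1.le
    · exact right_mem_Icc.2 hγ.1.le
  obtain ⟨j, t, ht, hjt⟩ := (mem_arcSupport.1 (hsub ⟨s, hsI, rfl⟩)).resolve_left hV
  refine ⟨j, t, ht, hjt, ?_⟩
  have htI := Ioo_subset_Icc_self ht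
  refine (abs_signedCurvature_eq (hγ.2.1 s hsI) (hγ.2.2 s hsI) (h.analyticAt j htI)
    (h.deriv_ne_zero j htI) hjt.symm fun U hU => ?_).symm
  have h1 : ∀ᶠ y in 𝓝 s, γ y ∈ arcSupport V c → γ y ∈ c j '' U := by
    have := h.eventually_mem_image j ht hU
    rw [hjt] at this
    exact (hγ.2.1 s hsI).continuousAt.eventually this
  have h2 : ∃ᶠ y in 𝓝[≠] s, y ∈ Icc a b := by
    rcases hs with rfl | rfl
    · refine Frequently.filter_mono (f := 𝓝[>] s) ?_ (nhdsWithin_mono _ fun x hx => ne_of_gt hx)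
      exact (eventually_of_mem (Ioo_mem_nhdsGT hγ.1) fun y hy => Ioo_subset_Icc_self hy).frequently
    · refine Frequently.filter_mono (f := 𝓝[<] s) ?_ (nhdsWithin_mono _ fun x hx => ne_of_lt hx)
      exact (eventually_of_mem (Ioo_mem_nhdsLT hγ.1) fun y hy => Ioo_subset_Icc_self hy).frequently
  exact (h2.and_eventually (h1.filter_mono nhdsWithin_le_nhds)).mono
    fun y hy => hy.2 (hsub ⟨y, hy.1, rfl⟩)

/-- The absolute curvature of a regular analytic arc that takes some nonzero value infinitely often
has this value everywhere. -/
theorem abs_signedCurvature_eq_of_infinite {γ : ℝ → Plane} {a b d : ℝ}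
    (hγ : IsRegularAnalyticSegment γ a b) (hd : 0 < d)
    (hinf : {t ∈ Icc a b | |signedCurvature γ t| = d⁻¹}.Infinite) :
    |signedCurvature γ a| = d⁻¹ := by
  set f : ℝ → ℝ := fun t => d ^ 2 *
    (deriv γ t 0 * deriv (deriv γ) t 1 - deriv γ t 1 * deriv (deriv γ) t 0) ^ 2 -
      (deriv γ t 0 ^ 2 + deriv γ t 1 ^ 2) ^ 3 with hf
  have hiff : ∀ t ∈ Icc a b, f t = 0 ↔ |signedCurvature γ t| = d⁻¹ := by
    intro t ht
    have hn : 0 < ‖deriv γ t‖ ^ 3 := pow_pos (norm_pos_iff.2 (hγ.2.2 t ht)) 3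
    simp only [hf, ← norm_sq_eq_coord]
    rw [signedCurvature, abs_div, abs_of_pos hn, div_eq_iff hn.ne', sub_eq_zero, ← mul_pow,
      ← pow_mul, mul_comm 2 3, pow_mul, sq_eq_sq_iff_abs_eq_abs, abs_mul, abs_of_pos hd,
      abs_of_pos hn, eq_inv_mul_iff_mul_eq₀ hd.ne']
  have hfa : AnalyticOnNhd ℝ f (Icc a b) := by
    intro t ht
    have h1 := fun i => analyticAt_coord (hγ.2.1 t ht).deriv i
    have h2 := fun i => analyticAt_coord (hγ.2.1 t ht).deriv.deriv i
    exact (analyticAt_const.mul ((((h1 0).mul (h2 1)).sub ((h1 1).mul (h2 0))).pow 2)).sub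
      ((((h1 0).pow 2).add ((h1 1).pow 2)).pow 3)
  obtain ⟨t, ht, hacc⟩ := hinf.exists_accPt_of_subset_isCompact isCompact_Icc (sep_subset _ _)
  rw [accPt_iff_frequently_nhdsNE] at hacc
  have h0 := hfa.eqOn_zero_of_preconnected_of_frequently_eq_zero isPreconnected_Icc ht
    (hacc.mono fun y hy => (hiff y hy.1).2 hy.2)
  have ha : a ∈ Icc a b := left_mem_Icc.2 hγ.1.le
  exact (hiff a ha).1 (h0 ha)

/-- Only finitely many radii of curvature occur at infinitely many points of a network each. -/
theorem IsArcNetwork.finite_curvature_radii [Finite ι] (h : IsArcNetwork V c) :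
    {d : ℝ | 0 < d ∧ {x : Plane | ∃ j, ∃ t ∈ Ioo (0 : ℝ) 1, c j t = x ∧
      |signedCurvature (c j) t| = d⁻¹}.Infinite}.Finite := by
  refine (finite_range fun j => |signedCurvature (c j) 0|⁻¹).subset ?_
  rintro d ⟨hd, hinf⟩
  have hU : {x : Plane | ∃ j, ∃ t ∈ Ioo (0 : ℝ) 1, c j t = x ∧ |signedCurvature (c j) t| = d⁻¹} ⊆
      ⋃ j, c j '' {t ∈ Icc (0 : ℝ) 1 | |signedCurvature (c j) t| = d⁻¹} := by
    rintro x ⟨j, t, ht, rfl, hk⟩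
    exact mem_iUnion.2 ⟨j, t, ⟨Ioo_subset_Icc_self ht, hk⟩, rfl⟩
  obtain ⟨j, hj⟩ : ∃ j, {t ∈ Icc (0 : ℝ) 1 | |signedCurvature (c j) t| = d⁻¹}.Infinite := by
    by_contra! hn
    exact hinf ((finite_iUnion fun j => (hn j).image (c j)).subset hU)
  refine ⟨j, ?_⟩
  simp only
  rw [abs_signedCurvature_eq_of_infinite (h.regular j) hd hj, inv_inv]

end Network

/-! ### Offset curves -/

/-- The curve parallel to `α` at the signed distance `e`, measured to the left of `α`. -/
def offset (e : ℝ) (α : ℝ → Plane) (s : ℝ) : Plane :=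
  α s + (e / ‖deriv α s‖) • rotLeft (deriv α s)

section Offset
variable {α : ℝ → Plane} {e s : ℝ}

theorem analyticAt_offset (hα : AnalyticAt ℝ α s) (hα' : deriv α s ≠ 0) :
    AnalyticAt ℝ (offset e α) s :=
  hα.add ((analyticAt_const.div (analyticAt_norm hα.deriv hα') (norm_ne_zero_iff.2 hα')).smul
    (analyticAt_rotLeft hα.deriv))

theorem dist_offset (hα' : deriv α s ≠ 0) : dist (offset e α s) (α s) = |e| := by
  rw [dist_eq_norm, offset, add_sub_cancel_left, norm_smul, norm_rotLeft, norm_div, norm_norm,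
    Real.norm_eq_abs, div_mul_cancel₀ _ (norm_ne_zero_iff.2 hα')]

theorem inner_offset_sub (x : Plane) :
    inner ℝ (offset e α s - x) (deriv α s) = inner ℝ (α s - x) (deriv α s) := by
  rw [offset, add_sub_right_comm, inner_add_left, real_inner_smul_left, inner_rotLeft_self,
    mul_zero, add_zero]

/-- The tangent of an offset curve is parallel to that of the original curve. -/
theorem deriv_offset (hα : AnalyticAt ℝ α s) (hα' : deriv α s ≠ 0) (he : e ≠ 0) :
    deriv (offset e α) s =
      (inner ℝ (deriv (offset e α) s) (deriv α s) / ‖deriv α s‖ ^ 2) • deriv α s := by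
  apply eq_smul_of_inner_rotLeft hα'
  have hd := ((analyticAt_offset (e := e) hα hα').differentiableAt.hasDerivAt.sub
    hα.differentiableAt.hasDerivAt)
  have h1 := hd.norm_sq
  have h2 : (fun u => ‖(offset e α - α) u‖ ^ 2) =ᶠ[𝓝 s] fun _ => |e| ^ 2 := by
    filter_upwards [eventually_deriv_ne_zero hα hα'] with u hu
    rw [Pi.sub_apply, ← dist_eq_norm, dist_offset hu]
  have h3 := h1.unique ((hasDerivAt_const s (|e| ^ 2)).congr_of_eventuallyEq h2)
  have h4 : (offset e α - α) s = (e / ‖deriv α s‖) • rotLeft (deriv α s) := by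
    rw [Pi.sub_apply, offset, add_sub_cancel_left]
  rw [h4, real_inner_smul_left, inner_sub_right, inner_rotLeft_self, sub_zero] at h3
  have h5 : e / ‖deriv α s‖ ≠ 0 := div_ne_zero he (norm_ne_zero_iff.2 hα')
  rw [real_inner_comm]
  simpa [h5] using h3

end Offset

theorem strictMonoOn_Ico_of_hasDerivAt {f f' : ℝ → ℝ} {a b : ℝ}
    (h : ∀ x ∈ Ico a b, HasDerivAt f (f' x) x) (h' : ∀ x ∈ Ioo a b, 0 < f' x) :
    StrictMonoOn f (Ico a b) := by
  refine strictMonoOn_of_deriv_pos (convex_Ico a b)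
    (fun x hx => (h x hx).continuousAt.continuousWithinAt) fun x hx => ?_
  rw [interior_Ico] at hx
  rw [(h x (Ioo_subset_Ico_self hx)).deriv]
  exact h' x hx

/-- Let `α` stay, to the right of the parameter value `0`, outside of the open disk of radius `|e|`
whose center is the point `offset e α 0` of its offset curve. To the right of `0`, the
curvature of `α` is then either identically or nowhere equal to that of the circle, and in the
latter case the disk forces the offset curve to go in the same direction as `α`: by analyticity, the
tangent of the offset curve is a multiple of the tangent of `α` with a factor of constant sign, and
a negative factor would make the distance from `α` to the center of the disk decrease. -/
theorem offset_const_or_strictMonoOn {α : ℝ → Plane} {e : ℝ} (hα : AnalyticAt ℝ α 0)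
    (hα' : deriv α 0 ≠ 0) (he : e ≠ 0)
    (hdist : ∀ᶠ s in 𝓝[>] 0, |e| ≤ dist (α s) (offset e α 0)) :
    (∀ᶠ s in 𝓝[>] 0, offset e α s = offset e α 0) ∨
      ∃ ε > 0, StrictMonoOn (fun s => inner ℝ (offset e α s) (deriv α 0)) (Ico 0 ε) ∧
        ∀ s ∈ Ioo 0 ε, |e| < dist (offset e α s) (α 0) := by
  set A := offset e α with hA
  have hAa : AnalyticAt ℝ A 0 := analyticAt_offset hα hα'
  set m : ℝ → ℝ := fun s => inner ℝ (deriv A s) (deriv α s) / ‖deriv α s‖ ^ 2 with hm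
  have hma : AnalyticAt ℝ m 0 := (analyticAt_inner hAa.deriv hα.deriv).div
    ((analyticAt_norm hα.deriv hα').pow 2) (pow_ne_zero 2 (norm_ne_zero_iff.2 hα'))
  -- Near `0`, the tangents of `α` form acute angles.
  obtain ⟨T, hT, hacute⟩ : ∃ T ∈ 𝓝 (0 : ℝ), ∀ s ∈ T, ∀ u ∈ T,
      0 < inner ℝ (deriv α s) (deriv α u) := by
    have hc : ContinuousAt (fun z : ℝ × ℝ => inner ℝ (deriv α z.1) (deriv α z.2)) (0, 0) := by
      have h := hα.deriv.continuousAt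
      exact ContinuousAt.inner (𝕜 := ℝ)
        (ContinuousAt.comp (g := deriv α) (f := Prod.fst) (x := ((0 : ℝ), (0 : ℝ))) h
          continuousAt_fst)
        (ContinuousAt.comp (g := deriv α) (f := Prod.snd) (x := ((0 : ℝ), (0 : ℝ))) h
          continuousAt_snd)
    have h0 : ∀ᶠ z : ℝ × ℝ in 𝓝 (0, 0), 0 < inner ℝ (deriv α z.1) (deriv α z.2) :=
      hc.eventually (lt_mem_nhds (by simpa using real_inner_self_pos.2 hα'))
    rw [nhds_prod_eq] at h0
    obtain ⟨T, hT, H⟩ := eventually_prod_self_iff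
      (r := fun s u => 0 < inner ℝ (deriv α s) (deriv α u)).1 h0
    exact ⟨T, hT, H⟩
  obtain ⟨δ, hδ, hball⟩ := Metric.eventually_nhds_iff_ball.1
    ((eventually_mem_set.2 hT).and (hα.eventually_analyticAt.and
      (eventually_deriv_ne_zero hα hα')))
  -- `ε` is chosen for a given condition to the right of `0`.
  have key : ∀ P : ℝ → Prop, (∀ᶠ s in 𝓝[>] (0 : ℝ), P s) → ∃ ε > 0,
      (∀ s ∈ Ico 0 ε, s ∈ T ∧ AnalyticAt ℝ α s ∧ deriv α s ≠ 0) ∧ ∀ s ∈ Ioo 0 ε, P s := by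
    intro P hP
    obtain ⟨ε, hε, H⟩ := mem_nhdsGT_iff_exists_Ioo_subset.1 hP
    refine ⟨min ε δ, lt_min hε hδ, fun s hs => ?_,
      fun s hs => H ⟨hs.1, hs.2.trans_le (min_le_left _ _)⟩⟩
    obtain ⟨h1, h2, h3⟩ := hball s (by
      rw [Metric.mem_ball, Real.dist_eq, sub_zero, abs_of_nonneg hs.1]
      exact hs.2.trans_le (min_le_right _ _))
    exact ⟨h1, h2, h3⟩
  have hAderiv : ∀ {s : ℝ}, AnalyticAt ℝ α s → deriv α s ≠ 0 →
      HasDerivAt A (m s • deriv α s) s := by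
    intro s h1 h2
    have := (analyticAt_offset (e := e) h1 h2).differentiableAt.hasDerivAt
    rwa [deriv_offset h1 h2 he] at this
  have hAinner : ∀ {s : ℝ} (v : Plane), AnalyticAt ℝ α s → deriv α s ≠ 0 →
      HasDerivAt (fun u => inner ℝ (A u) v) (m s * inner ℝ (deriv α s) v) s := by
    intro s v h1 h2
    simpa [real_inner_smul_left] using (hAderiv h1 h2).inner ℝ (hasDerivAt_const s v)
  rcases eventually_sign_right hma with hz | hp | hn
  · left
    obtain ⟨ε, hε, H, hz'⟩ := key _ (hz.filter_mono nhdsWithin_le_nhds)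
    filter_upwards [Ioo_mem_nhdsGT hε] with s hs
    refine (constant_of_has_deriv_right_zero (f := A) (a := 0) (b := s) ?_ ?_) s
      (right_mem_Icc.2 hs.1.le)
    · intro u hu
      have := H u ⟨hu.1, hu.2.trans_lt hs.2⟩
      exact (hAderiv this.2.1 this.2.2).continuousAt.continuousWithinAt
    · intro u hu
      have hu' := H u ⟨hu.1, hu.2.trans hs.2⟩
      have hmu : m u = 0 := by
        rcases hu.1.eq_or_lt with rfl | h0
        · exact hz.self_of_nhds
        · exact hz' u ⟨h0, hu.2.trans hs.2⟩
      have := hAderiv hu'.2.1 hu'.2.2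
      rw [hmu, zero_smul] at this
      exact this.hasDerivWithinAt
  · right
    obtain ⟨ε, hε, H, hp'⟩ := key _ hp
    refine ⟨ε, hε, ?_, ?_⟩
    · refine strictMonoOn_Ico_of_hasDerivAt (fun s hs => hAinner _ (H s hs).2.1 (H s hs).2.2)
        fun s hs => mul_pos (hp' s hs) (hacute _ (H s (Ioo_subset_Ico_self hs)).1 _ ?_)
      exact (H 0 (left_mem_Ico.2 hε)).1
    · have hmono : StrictMonoOn (fun s => ‖A s - α 0‖ ^ 2) (Ico 0 ε) := by
        refine strictMonoOn_Ico_of_hasDerivAt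
          (fun s hs => ((hAderiv (H s hs).2.1 (H s hs).2.2).sub_const (α 0)).norm_sq) ?_
        intro s hs
        have hs' := Ioo_subset_Ico_self hs
        have hαmono : StrictMonoOn (fun u => inner ℝ (α u) (deriv α s)) (Ico 0 ε) :=
          strictMonoOn_Ico_of_hasDerivAt (fun u hu => hasDerivAt_inner_const (H u hu).2.1 _)
            fun u hu => hacute _ (H u (Ioo_subset_Ico_self hu)).1 _ (H s hs').1
        have h1 := hαmono (left_mem_Ico.2 hε) hs' hs.1
        have h2 : 0 < inner ℝ (A s - α 0) (deriv α s) := by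
          rw [hA, inner_offset_sub, inner_sub_left]
          exact sub_pos.2 h1
        rw [inner_smul_right]
        exact mul_pos two_pos (mul_pos (hp' s hs) h2)
      intro s hs
      have h1 := hmono (left_mem_Ico.2 hε) (Ioo_subset_Ico_self hs) hs.1
      simp only [← dist_eq_norm] at h1
      rw [hA, dist_offset hα'] at h1
      exact lt_of_pow_lt_pow_left₀ 2 dist_nonneg h1
  · exfalso
    obtain ⟨ε, hε, H, hn'⟩ := key _ (hn.and hdist)
    have hmono : StrictMonoOn (fun s => -‖α s - A 0‖ ^ 2) (Ico 0 ε) := by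
      refine strictMonoOn_Ico_of_hasDerivAt
        (fun s hs => (hasDerivAt_norm_sq (H s hs).2.1 (A 0)).neg) ?_
      intro s hs
      have hs' := Ioo_subset_Ico_self hs
      have hAmono : StrictMonoOn (fun u => -inner ℝ (A u) (deriv α s)) (Ico 0 ε) :=
        strictMonoOn_Ico_of_hasDerivAt
          (fun u hu => (hAinner (deriv α s) (H u hu).2.1 (H u hu).2.2).neg)
          fun u hu => neg_pos.2 (mul_neg_of_neg_of_pos (hn' u hu).1
            (hacute _ (H u (Ioo_subset_Ico_self hu)).1 _ (H s hs').1))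
      have h1 := hAmono (left_mem_Ico.2 hε) hs' hs.1
      simp only [neg_lt_neg_iff] at h1
      have h2 : inner ℝ (α s - A 0) (deriv α s) < 0 := by
        rw [← inner_offset_sub (e := e), inner_sub_left]
        exact sub_neg.2 h1
      linarith
    have hmem : ε / 2 ∈ Ioo 0 ε := ⟨by positivity, by linarith⟩
    have h1 := hmono (left_mem_Ico.2 hε) (Ioo_subset_Ico_self hmem) hmem.1
    simp only [neg_lt_neg_iff, ← dist_eq_norm] at h1
    rw [dist_comm (α 0), hA, dist_offset hα'] at h1
    exact absurd (hn' _ hmem).2 (not_le.2 (lt_of_pow_lt_pow_left₀ 2 (abs_nonneg e) h1))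

/-! ### Nearest points that collapse -/

/-- If an arc runs through a nearest point of `E` inside `E`, the direction to this nearest point is
normal to the arc. -/
theorem inner_eq_zero_of_mem_projections {E : Set Plane} {r : Plane} {α : ℝ → Plane} {s : ℝ}
    (hα : DifferentiableAt ℝ α s) (hE : ∀ᶠ u in 𝓝 s, α u ∈ E) (h : α s ∈ projections r E) :
    inner ℝ (r - α s) (deriv α s) = 0 := by
  have hmin : IsLocalMin (fun u => ‖α u - r‖ ^ 2) s := by
    filter_upwards [hE] with u hu
    have := h.2 _ hu
    rw [dist_comm, dist_eq_norm, dist_comm, dist_eq_norm] at this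
    exact pow_le_pow_left₀ (norm_nonneg _) this 2
  have h0 := hmin.hasDerivAt_eq_zero (hα.hasDerivAt.sub_const r).norm_sq
  rw [← neg_sub, inner_neg_left]
  linarith

/-- The curve `α`, considered for small positive parameter values, is a regular analytic arc in `E`
that starts from the point `p`. -/
structure IsBranch (E : Set Plane) (p : Plane) (α : ℝ → Plane) : Prop where
  analyticAt : AnalyticAt ℝ α 0
  deriv_ne_zero : deriv α 0 ≠ 0
  apply_zero : α 0 = p
  mem : ∀ᶠ u in 𝓝[>] (0 : ℝ), α u ∈ E

/-- The points `r k`, which tend to `x` along the ultrafilter `U` without being equal to `x`, are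
at the distance `d` from `E`, and `p k` are nearest points of `E` that tend to a nearest point `y`
of `x`. -/
structure IsNearestSeq (E : Set Plane) (d : ℝ) (U : Ultrafilter ℕ) (r p : ℕ → Plane)
    (x y : Plane) : Prop where
  pos : 0 < d
  tendsto : Tendsto r U (𝓝 x)
  ne : ∀ᶠ k in U, r k ≠ x
  tendsto' : Tendsto p U (𝓝 y)
  dist_eq : ∀ k, dist (r k) (p k) = d
  mem : ∀ k, p k ∈ projections (r k) E
  dist_eq' : dist x y = d
  mem' : y ∈ projections x E

section Branch
variable {E : Set Plane} {d : ℝ} {U : Ultrafilter ℕ} {r p : ℕ → Plane} {x y : Plane}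
  {α β : ℝ → Plane} {u : ℕ → ℝ}

theorem IsBranch.inner_eq_zero (hα : IsBranch E y α) :
    ∀ᶠ s in 𝓝[>] (0 : ℝ), ∀ z, α s ∈ projections z E → inner ℝ (z - α s) (deriv α s) = 0 := by
  have h1 : ∀ᶠ s in 𝓝[>] (0 : ℝ), ∀ᶠ u in 𝓝 s, α u ∈ E := by
    filter_upwards [eventually_eventually_nhdsWithin.2 hα.mem, self_mem_nhdsWithin] with s hs hs0
    rwa [isOpen_Ioi.nhdsWithin_eq hs0] at hs
  filter_upwards [h1, hα.analyticAt.eventually_analyticAt.filter_mono nhdsWithin_le_nhds]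
    with s hs hs' z hz
  exact inner_eq_zero_of_mem_projections hs'.differentiableAt hs hz

theorem IsNearestSeq.exists_offset (h : IsNearestSeq E d U r p x y) (hα : IsBranch E y α)
    (hu : Tendsto u U (𝓝[>] 0)) (hp : ∀ᶠ k in U, p k = α (u k)) :
    ∃ e, |e| = d ∧ offset e α 0 = x := by
  have hu0 : Tendsto u U (𝓝 0) := hu.mono_right nhdsWithin_le_nhds
  have h0 : inner ℝ (x - α 0) (deriv α 0) = 0 := by
    have h1 : Tendsto (fun k => inner ℝ (r k - p k) (deriv α (u k))) U
        (𝓝 (inner ℝ (x - y) (deriv α 0))) :=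
      (h.tendsto.sub h.tendsto').inner (hα.analyticAt.deriv.continuousAt.tendsto.comp hu0)
    have h2 : ∀ᶠ k in U, inner ℝ (r k - p k) (deriv α (u k)) = 0 := by
      filter_upwards [hu.eventually hα.inner_eq_zero, hp] with k hk hpk
      rw [hpk]
      exact hk _ (hpk ▸ h.mem k)
    rw [hα.apply_zero]
    exact tendsto_nhds_unique_of_eventuallyEq h1 tendsto_const_nhds h2
  have hn : ‖deriv α 0‖ ≠ 0 := norm_ne_zero_iff.2 hα.deriv_ne_zero
  have h1 := eq_smul_rotLeft hα.deriv_ne_zero h0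
  set a := inner ℝ (x - α 0) (rotLeft (deriv α 0)) / ‖deriv α 0‖ ^ 2
  have h2 : offset (a * ‖deriv α 0‖) α 0 = x := by
    rw [offset, mul_div_assoc, div_self hn, mul_one, ← h1, add_sub_cancel]
  refine ⟨_, ?_, h2⟩
  rw [← dist_offset hα.deriv_ne_zero, h2, hα.apply_zero, h.dist_eq']

theorem IsNearestSeq.eventually_eq_offset (h : IsNearestSeq E d U r p x y) (hα : IsBranch E y α)
    (hu : Tendsto u U (𝓝[>] 0)) (hp : ∀ᶠ k in U, p k = α (u k)) {e : ℝ} (he : |e| = d)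
    (hx : offset e α 0 = x) : ∀ᶠ k in U, r k = offset e α (u k) := by
  have hu0 : Tendsto u U (𝓝 0) := hu.mono_right nhdsWithin_le_nhds
  have h1 : ∀ᶠ k in U, r k = offset e α (u k) ∨ r k - p k = -(offset e α (u k) - α (u k)) := by
    filter_upwards [hu.eventually hα.inner_eq_zero, hp,
      hu0.eventually (eventually_deriv_ne_zero hα.analyticAt hα.deriv_ne_zero)] with k h1 h2 h3
    rw [h2]
    refine (eq_or_eq_neg_of_inner_eq_zero h3 (h1 _ (h2 ▸ h.mem k)) ?_ ?_).imp_left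
      fun h => sub_left_injective h
    · rw [inner_offset_sub, sub_self, inner_zero_left]
    · rw [← dist_eq_norm, ← dist_eq_norm, dist_offset h3, he, ← h.dist_eq k, h2]
  rcases Ultrafilter.eventually_or.1 h1 with h1 | h1
  · exact h1
  · exfalso
    have hA := (analyticAt_offset (e := e) hα.analyticAt hα.deriv_ne_zero).continuousAt.tendsto
    have h2 : Tendsto (fun k => -(offset e α (u k) - α (u k))) U (𝓝 (-(x - y))) := by
      rw [← hx, ← hα.apply_zero]
      exact ((hA.comp hu0).sub (hα.analyticAt.continuousAt.tendsto.comp hu0)).neg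
    have h3 := tendsto_nhds_unique_of_eventuallyEq (h.tendsto.sub h.tendsto') h2 h1
    have h4 : x - y = 0 := by
      have h5 : (2 : ℝ) • (x - y) = 0 := by rw [two_smul]; exact eq_neg_iff_add_eq_zero.1 h3
      exact (smul_eq_zero.1 h5).resolve_left two_ne_zero
    have h5 := h.dist_eq'
    rw [dist_eq_norm, h4, norm_zero] at h5
    exact h.pos.ne h5

/-- If the nearest points are on a branch, the centers `r k` are on its offset curve, which goes in
the direction of the branch and away from its initial point. It is not constant, as `r k ≠ x`. -/
theorem IsNearestSeq.strictMonoOn (h : IsNearestSeq E d U r p x y) (hα : IsBranch E y α)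
    (hu : Tendsto u U (𝓝[>] 0)) (hp : ∀ᶠ k in U, p k = α (u k)) {e : ℝ} (he : |e| = d)
    (hx : offset e α 0 = x) :
    ∃ ε > 0, StrictMonoOn (fun s => inner ℝ (offset e α s) (deriv α 0)) (Ico 0 ε) ∧
      ∀ s ∈ Ioo 0 ε, d < dist (offset e α s) y := by
  have he0 : e ≠ 0 := by
    rintro rfl
    rw [abs_zero] at he
    exact h.pos.ne he
  have hd : ∀ᶠ s in 𝓝[>] 0, |e| ≤ dist (α s) (offset e α 0) := by
    filter_upwards [hα.mem] with s hs
    rw [hx, he, ← h.dist_eq', dist_comm (α s)]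
    exact h.mem'.2 _ hs
  rcases offset_const_or_strictMonoOn hα.analyticAt hα.deriv_ne_zero he0 hd with h1 | h1
  · exfalso
    obtain ⟨k, h2, h3, h4⟩ := (h.ne.and ((h.eventually_eq_offset hα hu hp he hx).and
      (hu.eventually h1))).exists
    exact h2 (by rw [h3, h4, hx])
  · rwa [he, hα.apply_zero] at h1

theorem IsNearestSeq.inner_lt (h : IsNearestSeq E d U r p x y) (hα : IsBranch E y α)
    (hu : Tendsto u U (𝓝[>] 0)) (hp : ∀ᶠ k in U, p k = α (u k)) :
    ∀ᶠ k in U, inner ℝ x (deriv α 0) < inner ℝ (r k) (deriv α 0) := by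
  obtain ⟨e, he, hx⟩ := h.exists_offset hα hu hp
  obtain ⟨ε, hε, hmono, -⟩ := h.strictMonoOn hα hu hp he hx
  filter_upwards [h.eventually_eq_offset hα hu hp he hx, hu.eventually (Ioo_mem_nhdsGT hε)]
    with k h1 h2
  rw [h1, ← hx]
  exact hmono (left_mem_Ico.2 hε) (Ioo_subset_Ico_self h2) h2.1

/-- A ball rolling along a branch does not touch the initial point of the branch. -/
theorem IsNearestSeq.lt_dist (h : IsNearestSeq E d U r p x y) (hα : IsBranch E y α)
    (hu : Tendsto u U (𝓝[>] 0)) (hp : ∀ᶠ k in U, p k = α (u k)) :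
    ∀ᶠ k in U, d < dist (r k) y := by
  obtain ⟨e, he, hx⟩ := h.exists_offset hα hu hp
  obtain ⟨ε, hε, -, hlt⟩ := h.strictMonoOn hα hu hp he hx
  filter_upwards [h.eventually_eq_offset hα hu hp he hx, hu.eventually (Ioo_mem_nhdsGT hε)]
    with k h1 h2
  rw [h1]
  exact hlt _ h2

/-- A ball rolling along a branch touches it at one point only. -/
theorem IsNearestSeq.eventually_eq {q : ℕ → Plane} {w : ℕ → ℝ} (h : IsNearestSeq E d U r p x y)
    (h' : IsNearestSeq E d U r q x y) (hα : IsBranch E y α)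
    (hu : Tendsto u U (𝓝[>] 0)) (hp : ∀ᶠ k in U, p k = α (u k))
    (hw : Tendsto w U (𝓝[>] 0)) (hq : ∀ᶠ k in U, q k = α (w k)) :
    ∀ᶠ k in U, p k = q k := by
  obtain ⟨e, he, hx⟩ := h.exists_offset hα hu hp
  obtain ⟨ε, hε, hmono, -⟩ := h.strictMonoOn hα hu hp he hx
  filter_upwards [h.eventually_eq_offset hα hu hp he hx, hu.eventually (Ioo_mem_nhdsGT hε),
    h'.eventually_eq_offset hα hw hq he hx, hw.eventually (Ioo_mem_nhdsGT hε), hp, hq]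
    with k h1 h2 h3 h4 h5 h6
  rw [h5, h6, hmono.injOn (Ioo_subset_Ico_self h2) (Ioo_subset_Ico_self h4)
    (by simp only [← h1, ← h3])]

/-- No point of `E` lies slightly above a nearest point `p k`, in the direction `x - y`, since it
would be in the ball of radius `d` centered at `r k`. -/
theorem IsNearestSeq.false_of_push (h : IsNearestSeq E d U r p x y) {η : ℕ → ℝ}
    (hη : Tendsto η U (𝓝 0)) (hη0 : ∀ᶠ k in U, 0 < η k)
    (hE : ∀ᶠ k in U, p k + η k • (x - y) ∈ E) : False := by
  have h1 : ∀ᶠ k in U, 2 * inner ℝ (r k - p k) (x - y) ≤ η k * d ^ 2 := by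
    filter_upwards [hη0, hE] with k h1 h2
    have h3 := (h.mem k).2 _ h2
    rw [h.dist_eq k, dist_eq_norm, ← sub_sub] at h3
    have h4 := pow_le_pow_left₀ h.pos.le h3 2
    rw [norm_sub_sq_real, ← dist_eq_norm, h.dist_eq k, norm_smul, ← dist_eq_norm, h.dist_eq',
      inner_smul_right, mul_pow, Real.norm_eq_abs, sq_abs] at h4
    refine le_of_mul_le_mul_left ?_ h1
    linarith
  have h2 : Tendsto (fun k => 2 * inner ℝ (r k - p k) (x - y)) U
      (𝓝 (2 * inner ℝ (x - y) (x - y))) :=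
    ((h.tendsto.sub h.tendsto').inner tendsto_const_nhds).const_mul 2
  have h3 : Tendsto (fun k => η k * d ^ 2) U (𝓝 (0 * d ^ 2)) := hη.mul_const _
  have h4 := le_of_tendsto_of_tendsto h2 h3 h1
  rw [real_inner_self_eq_norm_sq, ← dist_eq_norm, h.dist_eq', zero_mul] at h4
  have := pow_pos h.pos 2
  linarith

theorem tendsto_nhdsGT_of_deriv_pos {f : ℝ → ℝ} (hf : ContinuousAt f 0) (h0 : f 0 = 0)
    (h : 0 < deriv f 0) : Tendsto f (𝓝[>] 0) (𝓝[>] 0) := by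
  refine tendsto_nhdsWithin_iff.2 ⟨?_, ?_⟩
  · have := hf.tendsto
    rw [h0] at this
    exact this.mono_left nhdsWithin_le_nhds
  · filter_upwards [(eventually_nhdsWithin_sign_eq_of_deriv_pos h h0).filter_mono
      nhdsWithin_le_nhds, self_mem_nhdsWithin] with s hs hs0
    rw [sub_zero, sign_pos (mem_Ioi.1 hs0)] at hs
    exact sign_eq_one_iff.1 hs

/-- A ball cannot touch both branches of a cusp: seen in the direction `x - y`, one of the branches
lies above the other near `y`, as they do not meet again, and then no nearest point is on the lower
one. -/
theorem IsNearestSeq.false_of_cusp {q : ℕ → Plane} {w : ℕ → ℝ} (h : IsNearestSeq E d U r p x y)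
    (h' : IsNearestSeq E d U r q x y) (hα : IsBranch E y α) (hβ : IsBranch E y β)
    (hu : Tendsto u U (𝓝[>] 0)) (hp : ∀ᶠ k in U, p k = α (u k))
    (hw : Tendsto w U (𝓝[>] 0)) (hq : ∀ᶠ k in U, q k = β (w k))
    (hsep : ∀ᶠ z : ℝ × ℝ in 𝓝[>] 0 ×ˢ 𝓝[>] 0, α z.1 ≠ β z.2)
    (hdir : 0 < inner ℝ (deriv α 0) (deriv β 0)) (hperp : inner ℝ (x - y) (deriv β 0) = 0) :
    False := by
  have hα0 := hα.apply_zero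
  have hβ0 := hβ.apply_zero
  obtain ⟨φ, hφ, hφ0, -, hφ2⟩ := exists_normal_projection hα.analyticAt hβ.analyticAt
    hβ.deriv_ne_zero (hα0.trans hβ0.symm)
  set v := deriv β 0 with hv
  have hvpos : 0 < inner ℝ v v := real_inner_self_pos.2 hβ.deriv_ne_zero
  have hβφ : AnalyticAt ℝ (fun s => β (φ s)) 0 :=
    AnalyticAt.comp (g := β) (by rw [hφ0]; exact hβ.analyticAt) hφ
  have hφ' : 0 < deriv φ 0 := by
    have h1 : HasDerivAt (fun s => β (φ s)) (deriv φ 0 • v) 0 := by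
      have := HasDerivAt.scomp (g₁ := β) (0 : ℝ)
        (by rw [hφ0]; exact hβ.analyticAt.differentiableAt.hasDerivAt)
        hφ.differentiableAt.hasDerivAt
      exact this
    have h2 : HasDerivAt (fun s => inner ℝ (β (φ s)) v) (deriv φ 0 * inner ℝ v v) 0 := by
      simpa [real_inner_smul_left] using h1.inner ℝ (hasDerivAt_const (0 : ℝ) v)
    have h3 := (h2.congr_of_eventuallyEq (hφ2.mono fun s hs => hs.symm)).unique
      (hasDerivAt_inner_const hα.analyticAt v)
    exact (mul_pos_iff_of_pos_right hvpos).1 (h3 ▸ hdir)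
  have hφt : Tendsto φ (𝓝[>] 0) (𝓝[>] 0) := tendsto_nhdsGT_of_deriv_pos hφ.continuousAt hφ0 hφ'
  -- `g s` is the height of `α` over `β`, in units of `x - y`.
  set g : ℝ → ℝ := fun s => inner ℝ (α s - β (φ s)) (x - y) / d ^ 2 with hg
  have hga : AnalyticAt ℝ g 0 := (analyticAt_inner (hα.analyticAt.sub hβφ) analyticAt_const).div
    analyticAt_const (pow_pos h.pos 2).ne'
  have hg0 : g 0 = 0 := by simp [hg, hφ0, hα0, hβ0]
  have hgs : ∀ᶠ s in 𝓝 0, α s = β (φ s) + g s • (x - y) := by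
    filter_upwards [hφ2] with s hs
    have h1 : inner ℝ (α s - β (φ s)) v = 0 := by rw [inner_sub_left, hs, sub_self]
    have h2 : x - y ≠ 0 := by
      rw [← norm_pos_iff, ← dist_eq_norm, h.dist_eq']
      exact h.pos
    have h3 : inner ℝ (α s - β (φ s)) (rotLeft (x - y)) = 0 := by
      rw [real_inner_comm]
      exact inner_rotLeft_eq_zero_of_orthogonal hβ.deriv_ne_zero
        (by rw [real_inner_comm]; exact hperp)
        (by rw [real_inner_comm]; exact h1)
    have h4 := eq_smul_of_inner_rotLeft h2 h3
    rw [← dist_eq_norm x, h.dist_eq'] at h4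
    rw [← h4, add_sub_cancel]
  have hgt : ∀ {t : ℕ → ℝ}, Tendsto t U (𝓝[>] 0) → Tendsto (fun k => g (t k)) U (𝓝 0) := by
    intro t ht
    have := hga.continuousAt.tendsto
    rw [hg0] at this
    exact this.comp (ht.mono_right nhdsWithin_le_nhds)
  rcases eventually_sign_right hga with hz | hpos | hneg
  · have h1 : ∀ᶠ s in 𝓝[>] 0, α s ≠ β (φ s) := (tendsto_id.prodMk hφt).eventually hsep
    obtain ⟨s, h2, h3, h4⟩ := (h1.and ((hz.filter_mono nhdsWithin_le_nhds).and
      (hgs.filter_mono nhdsWithin_le_nhds))).exists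
    exact h2 (by rw [h4, h3, zero_smul, add_zero])
  · -- The point of `α` over `q k = β (w k)` is `α (ψ (w k))`, where `ψ` is the inverse of `φ`.
    set ψ := hφ.hasStrictDerivAt.localInverse _ _ _ hφ'.ne' with hψ
    have hψd : HasStrictDerivAt ψ (deriv φ 0)⁻¹ 0 := by
      have := hφ.hasStrictDerivAt.to_localInverse hφ'.ne'
      rwa [hφ0] at this
    have hψ0 : ψ 0 = 0 := by
      have := (hφ.hasStrictDerivAt.eventually_left_inverse hφ'.ne').self_of_nhds
      rwa [hφ0] at this
    have hψr : ∀ᶠ t in 𝓝 0, φ (ψ t) = t := by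
      have := hφ.hasStrictDerivAt.eventually_right_inverse hφ'.ne'
      rwa [hφ0] at this
    have hψt : Tendsto ψ (𝓝[>] 0) (𝓝[>] 0) := tendsto_nhdsGT_of_deriv_pos
      hψd.hasDerivAt.continuousAt hψ0 (by rw [hψd.hasDerivAt.deriv]; exact inv_pos.2 hφ')
    have hψw := hψt.comp hw
    refine h'.false_of_push (hgt hψw) (hψw.eventually hpos) ?_
    filter_upwards [hψw.eventually hα.mem, hq,
      (hw.mono_right nhdsWithin_le_nhds).eventually hψr,
      (hψw.mono_right nhdsWithin_le_nhds).eventually hgs] with k h1 h2 h3 h4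
    simp only [Function.comp_apply] at h1 h4
    rw [h3] at h4
    rw [h2, Function.comp_apply, ← h4]
    exact h1
  · refine h.false_of_push (η := fun k => -g (u k)) (by simpa using (hgt hu).neg)
      ((hu.eventually hneg).mono fun k hk => neg_pos.2 hk) ?_
    filter_upwards [(hφt.comp hu).eventually hβ.mem, hp,
      (hu.mono_right nhdsWithin_le_nhds).eventually hgs] with k h1 h2 h3
    rw [h2, h3, neg_smul, add_neg_cancel_right]
    exact h1

/-- Two different nearest points of `r k` cannot tend to `y` along branches: on the same branch, the
monotone offset curve would take the same value twice; branches with opposite directions have offset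
curves that diverge; and two branches with the same direction form a cusp. -/
theorem IsNearestSeq.false_of_branches {q : ℕ → Plane} {w : ℕ → ℝ}
    (h : IsNearestSeq E d U r p x y) (h' : IsNearestSeq E d U r q x y) (hne : ∀ k, p k ≠ q k)
    (hα : IsBranch E y α) (hβ : IsBranch E y β)
    (hu : Tendsto u U (𝓝[>] 0)) (hp : ∀ᶠ k in U, p k = α (u k))
    (hw : Tendsto w U (𝓝[>] 0)) (hq : ∀ᶠ k in U, q k = β (w k))
    (hsep : α = β ∨ ∀ᶠ z : ℝ × ℝ in 𝓝[>] 0 ×ˢ 𝓝[>] 0, α z.1 ≠ β z.2) : False := by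
  rcases hsep with rfl | hsep
  · obtain ⟨k, hk⟩ := (h.eventually_eq h' hα hu hp hw hq).exists
    exact hne k hk
  have hxy : x - y ≠ 0 := by
    rw [← norm_pos_iff, ← dist_eq_norm, h.dist_eq']
    exact h.pos
  have hperp : ∀ {γ : ℝ → Plane} {e : ℝ}, γ 0 = y → offset e γ 0 = x →
      inner ℝ (x - y) (deriv γ 0) = 0 := by
    intro γ e h0 hx
    rw [← hx, inner_offset_sub, h0, sub_self, inner_zero_left]
  obtain ⟨e, -, hx⟩ := h.exists_offset hα hu hp
  obtain ⟨e', -, hx'⟩ := h'.exists_offset hβ hw hq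
  have hα1 := hperp hα.apply_zero hx
  have hβ1 := hperp hβ.apply_zero hx'
  have hpar := inner_rotLeft_eq_zero_of_orthogonal hxy hα1 hβ1
  rcases (inner_ne_zero_of_parallel hα.deriv_ne_zero hβ.deriv_ne_zero hpar).lt_or_gt with hlt | hgt
  · -- The branches start in opposite directions, and so do their offset curves.
    obtain ⟨k, h1, h2⟩ := ((h.inner_lt hα hu hp).and (h'.inner_lt hβ hw hq)).exists
    have h3 : deriv β 0 = _ := eq_smul_of_inner_rotLeft hα.deriv_ne_zero
      (by rw [real_inner_comm]; exact hpar)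
    have h4 : inner ℝ (deriv β 0) (deriv α 0) / ‖deriv α 0‖ ^ 2 < 0 :=
      div_neg_of_neg_of_pos (by rwa [real_inner_comm])
        (pow_pos (norm_pos_iff.2 hα.deriv_ne_zero) 2)
    rw [h3, inner_smul_right, inner_smul_right] at h2
    exact absurd h1 (not_lt.2 ((mul_lt_mul_left_of_neg h4).1 h2).le)
  · exact h.false_of_cusp h' hα hβ hu hp hw hq hsep hgt hβ1

end Branch

/-! ### Accumulation of points with several nearest points -/

theorem eventually_exists_of_finite {ι κ : Type*} [Finite ι] {U : Ultrafilter κ}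
    {P : ι → κ → Prop} (h : ∀ᶠ k in U, ∃ j, P j k) : ∃ j, ∀ᶠ k in U, P j k := by
  by_contra! hn
  have h1 : ∀ᶠ k in U, ∀ j, ¬P j k :=
    eventually_all.2 fun j => hn j
  obtain ⟨k, ⟨j, hj⟩, hk⟩ := (h.and h1).exists
  exact hk j hj

theorem exists_tendsto_of_eventually_mem {X κ : Type*} [TopologicalSpace X] {K : Set X}
    (hK : IsCompact K) {U : Ultrafilter κ} {f : κ → X} (h : ∀ᶠ k in U, f k ∈ K) :
    ∃ x ∈ K, Tendsto f U (𝓝 x) :=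
  hK.ultrafilter_le_nhds' (U.map f) h

section Network
variable {ι : Type*} {V : Set Plane} {c : ι → ℝ → Plane} {E : Set Plane}

/-- The curve `c` issuing from its point with the parameter value `s`, forward for `σ = 1` and
backward for `σ = -1`. -/
def branch (c : ℝ → Plane) (s σ : ℝ) (u : ℝ) : Plane := c (s + σ * u)

theorem eventually_mem_Ioo {s σ u : ℝ} (hs : s ∈ Icc (0 : ℝ) 1) (hu : 0 < u)
    (hsu : s + σ * u ∈ Ioo (0 : ℝ) 1) :
    ∀ᶠ w in 𝓝[>] (0 : ℝ), s + σ * w ∈ Ioo (0 : ℝ) 1 := by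
  filter_upwards [Ioo_mem_nhdsGT hu] with w hw
  have h1 : 0 < w / u := div_pos hw.1 hu
  have h2 : w / u < 1 := (div_lt_one hu).2 hw.2
  have h3 : s + σ * w = (1 - w / u) * s + (w / u) * (s + σ * u) := by field_simp; ring
  rw [h3]
  have h4 := mul_nonneg (sub_pos.2 h2).le hs.1
  have h5 := mul_le_mul_of_nonneg_left hs.2 (sub_pos.2 h2).le
  have h6 := mul_pos h1 hsu.1
  have h7 := mul_lt_mul_of_pos_left hsu.2 h1
  constructor <;> linarith

theorem IsArcNetwork.isBranch (h : IsArcNetwork V c) (hE : arcSupport V c ⊆ E) {j : ι} {s σ : ℝ}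
    (hs : s ∈ Icc (0 : ℝ) 1) (hσ : σ ≠ 0)
    (hev : ∀ᶠ w in 𝓝[>] (0 : ℝ), s + σ * w ∈ Ioo (0 : ℝ) 1) :
    IsBranch E (c j s) (branch (c j) s σ) := by
  have h0 : s + σ * 0 = s := by ring
  have ha : AnalyticAt ℝ (c j) (s + σ * 0) := by rw [h0]; exact h.analyticAt j hs
  have hl : HasDerivAt (fun u : ℝ => s + σ * u) σ 0 := by
    simpa using ((hasDerivAt_id (0 : ℝ)).const_mul σ).const_add s
  refine ⟨?_, ?_, ?_, ?_⟩
  · exact AnalyticAt.comp (g := c j) (f := fun u : ℝ => s + σ * u) ha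
      (analyticAt_const.add (analyticAt_const.mul analyticAt_id))
  · have h1 : HasDerivAt (branch (c j) s σ) (σ • deriv (c j) (s + σ * 0)) 0 :=
      HasDerivAt.scomp (g₁ := c j) (0 : ℝ) ha.differentiableAt.hasDerivAt hl
    rw [h1.deriv, h0]
    exact smul_ne_zero hσ (h.deriv_ne_zero j hs)
  · rw [branch, h0]
  · filter_upwards [hev] with w hw
    exact hE (h.mem_arcSupport_of_mem_Icc j (Ioo_subset_Icc_self hw))

/-- A sequence of points of a network converges along a branch, unless it is constant. -/
theorem IsArcNetwork.eventually_const_or_branch [Finite ι] (h : IsArcNetwork V c)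
    {U : Ultrafilter ℕ} {p : ℕ → Plane} {y : Plane} (hp : ∀ k, p k ∈ arcSupport V c)
    (hy : Tendsto p U (𝓝 y)) :
    (∀ᶠ k in U, p k = y) ∨ ∃ (j : ι) (s σ : ℝ) (u : ℕ → ℝ), s ∈ Icc (0 : ℝ) 1 ∧
      (σ = 1 ∨ σ = -1) ∧ c j s = y ∧ Tendsto u U (𝓝[>] 0) ∧
      (∀ᶠ w in 𝓝[>] (0 : ℝ), s + σ * w ∈ Ioo (0 : ℝ) 1) ∧
      ∀ᶠ k in U, p k = branch (c j) s σ (u k) := by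
  have h1 : ∀ᶠ k in U, p k ∈ V ∨ ∃ j, ∃ t ∈ Ioo (0 : ℝ) 1, c j t = p k :=
    Eventually.of_forall fun k => mem_arcSupport.1 (hp k)
  rcases Ultrafilter.eventually_or.1 h1 with h1 | h1
  · left
    have : Finite V := h.finite_vertices
    obtain ⟨v, hv⟩ := eventually_exists_of_finite (ι := V) (P := fun v k => p k = v)
      (h1.mono fun k hk => ⟨⟨p k, hk⟩, rfl⟩)
    have : (v : Plane) = y := tendsto_nhds_unique_of_eventuallyEq tendsto_const_nhds hy
      (hv.mono fun k hk => hk.symm)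
    exact this ▸ hv
  obtain ⟨j, hj⟩ := eventually_exists_of_finite h1
  obtain ⟨t, ht⟩ := skolem.1 hj
  obtain ⟨s, hs, hts⟩ := exists_tendsto_of_eventually_mem isCompact_Icc
    (ht.mono fun k hk => Ioo_subset_Icc_self hk.1)
  have hcs : c j s = y := tendsto_nhds_unique_of_eventuallyEq
    ((h.analyticAt j hs).continuousAt.tendsto.comp hts) hy (ht.mono fun k hk => hk.2)
  have hts0 : Tendsto (fun k => t k - s) U (𝓝 0) := by simpa using hts.sub_const s
  have key : ∀ σ : ℝ, (σ = 1 ∨ σ = -1) → (∀ᶠ k in U, 0 < σ * (t k - s)) →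
      ∃ (j : ι) (s σ : ℝ) (u : ℕ → ℝ), s ∈ Icc (0 : ℝ) 1 ∧
      (σ = 1 ∨ σ = -1) ∧ c j s = y ∧ Tendsto u U (𝓝[>] 0) ∧
      (∀ᶠ w in 𝓝[>] (0 : ℝ), s + σ * w ∈ Ioo (0 : ℝ) 1) ∧
      ∀ᶠ k in U, p k = branch (c j) s σ (u k) := by
    intro σ hσ hpos
    have hσ2 : σ * σ = 1 := by rcases hσ with rfl | rfl <;> norm_num
    have ht' : ∀ k, s + σ * (σ * (t k - s)) = t k := fun k => by
      rw [← mul_assoc, hσ2]; ring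
    refine ⟨j, s, σ, fun k => σ * (t k - s), hs, hσ, hcs, ?_, ?_, ?_⟩
    · exact tendsto_nhdsWithin_iff.2 ⟨by simpa using hts0.const_mul σ, hpos⟩
    · obtain ⟨k, hk, hk'⟩ := (hpos.and ht).exists
      exact eventually_mem_Ioo hs hk (by rw [ht' k]; exact hk'.1)
    · filter_upwards [ht] with k hk
      rw [branch, ht' k, hk.2]
  have htri : ∀ᶠ k in U, t k = s ∨ 0 < 1 * (t k - s) ∨ 0 < (-1) * (t k - s) :=
    Eventually.of_forall fun k => by
      rcases lt_trichotomy (t k) s with hlt | heq | hgt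
      · right; right; linarith
      · exact Or.inl heq
      · right; left; linarith
  rcases Ultrafilter.eventually_or.1 htri with h2 | h2
  · left
    filter_upwards [ht, h2] with k hk hk'
    rw [← hk.2, hk', hcs]
  · right
    rcases Ultrafilter.eventually_or.1 h2 with h2 | h2
    · exact key 1 (Or.inl rfl) h2
    · exact key (-1) (Or.inr rfl) h2

/-- Two branches of a network with the same initial point coincide or do not meet again. -/
theorem IsArcNetwork.branch_eq_or_separated (h : IsArcNetwork V c) {i j : ι} {s t σ τ : ℝ}
    (hσ : σ = 1 ∨ σ = -1) (hτ : τ = 1 ∨ τ = -1)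
    (hs : ∀ᶠ w in 𝓝[>] (0 : ℝ), s + σ * w ∈ Ioo (0 : ℝ) 1)
    (ht : ∀ᶠ w in 𝓝[>] (0 : ℝ), t + τ * w ∈ Ioo (0 : ℝ) 1) :
    branch (c i) s σ = branch (c j) t τ ∨
      ∀ᶠ z : ℝ × ℝ in 𝓝[>] 0 ×ˢ 𝓝[>] 0, branch (c i) s σ z.1 ≠ branch (c j) t τ z.2 := by
  by_cases heq : i = j ∧ s = t ∧ σ = τ
  · obtain ⟨rfl, rfl, rfl⟩ := heq
    exact Or.inl rfl
  right
  have hlim : ∀ a b : ℝ, Tendsto (fun w : ℝ => a + b * w) (𝓝[>] 0) (𝓝 a) := fun a b => by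
    have : Continuous fun w : ℝ => a + b * w := by fun_prop
    have h0 := this.tendsto 0
    simp only [mul_zero, add_zero] at h0
    exact h0.mono_left nhdsWithin_le_nhds
  have hne : s ≠ t → ∀ᶠ z : ℝ × ℝ in 𝓝[>] 0 ×ˢ 𝓝[>] 0, s + σ * z.1 ≠ t + τ * z.2 := fun hst =>
    (((hlim s σ).comp tendsto_fst).prodMk_nhds ((hlim t τ).comp tendsto_snd)).eventually
      (isOpen_ne_fun continuous_fst continuous_snd |>.mem_nhds hst)
  have hpos : ∀ᶠ z : ℝ × ℝ in 𝓝[>] 0 ×ˢ 𝓝[>] 0, 0 < z.1 ∧ 0 < z.2 :=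
    (tendsto_fst.eventually self_mem_nhdsWithin).and (tendsto_snd.eventually self_mem_nhdsWithin)
  have hne' : ∀ᶠ z : ℝ × ℝ in 𝓝[>] 0 ×ˢ 𝓝[>] 0, s ≠ t → s + σ * z.1 ≠ t + τ * z.2 := by
    by_cases hst : s = t
    · exact Eventually.of_forall fun _ hn => absurd hst hn
    · exact (hne hst).mono fun _ hz _ => hz
  filter_upwards [tendsto_fst.eventually hs, tendsto_snd.eventually ht, hpos, hne']
    with z h1 h2 h3 h4 h5
  obtain ⟨hij, h6⟩ := h.inj i j _ h1 _ h2 h5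
  have hst : s = t := by_contra fun hn => h4 hn h6
  refine heq ⟨hij, hst, ?_⟩
  rw [hst, add_right_inj] at h6
  rcases hσ with rfl | rfl <;> rcases hτ with rfl | rfl
  · rfl
  · linarith
  · linarith
  · rfl

/-- Different nearest points do not collapse to the same nearest point. -/
theorem IsArcNetwork.false_of_collapse [Finite ι] (h : IsArcNetwork V c)
    (hE : arcSupport V c ⊆ E) {d : ℝ} {U : Ultrafilter ℕ} {r p q : ℕ → Plane} {x y : Plane}
    (hp : ∀ k, p k ∈ arcSupport V c) (hq : ∀ k, q k ∈ arcSupport V c) (hne : ∀ k, p k ≠ q k)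
    (hp' : IsNearestSeq E d U r p x y) (hq' : IsNearestSeq E d U r q x y) : False := by
  have hone : ∀ {σ : ℝ}, (σ = 1 ∨ σ = -1) → σ ≠ 0 := by rintro σ (rfl | rfl) <;> norm_num
  rcases h.eventually_const_or_branch hp hp'.tendsto' with h1 | h1 <;>
    rcases h.eventually_const_or_branch hq hq'.tendsto' with h2 | h2
  · obtain ⟨k, h3, h4⟩ := (h1.and h2).exists
    exact hne k (h3.trans h4.symm)
  · obtain ⟨j, t, τ, w, ht, hτ, rfl, hw, hev, hqw⟩ := h2
    obtain ⟨k, h3, h4⟩ := (h1.and (hq'.lt_dist (h.isBranch hE ht (hone hτ) hev) hw hqw)).exists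
    rw [← h3, hp'.dist_eq k] at h4
    exact lt_irrefl _ h4
  · obtain ⟨j, t, τ, w, ht, hτ, rfl, hw, hev, hpw⟩ := h1
    obtain ⟨k, h3, h4⟩ := (h2.and (hp'.lt_dist (h.isBranch hE ht (hone hτ) hev) hw hpw)).exists
    rw [← h3, hq'.dist_eq k] at h4
    exact lt_irrefl _ h4
  · obtain ⟨i, s, σ, u, hs, hσ, hi, hu, hev, hpu⟩ := h1
    obtain ⟨j, t, τ, w, ht, hτ, hj, hw, hev', hqw⟩ := h2
    exact hp'.false_of_branches hq' hne (hi ▸ h.isBranch hE hs (hone hσ) hev)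
      (hj ▸ h.isBranch hE ht (hone hτ) hev') hu hpu hw hqw
      (h.branch_eq_or_separated hσ hτ hev hev')

/-- The limit direction `v` in which the points `r k` approach `x` is orthogonal to the segment from
`x` to its nearest point: moving by `r k - x` does not decrease the distance to `y`, and moving back
does not decrease the distance to `p k`. -/
theorem IsNearestSeq.inner_direction_eq_zero {d : ℝ} {U : Ultrafilter ℕ} {r p : ℕ → Plane}
    {x y v : Plane} (h : IsNearestSeq E d U r p x y)
    (hv : Tendsto (fun k => ‖r k - x‖⁻¹ • (r k - x)) U (𝓝 v)) : inner ℝ (x - y) v = 0 := by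
  have hδ : Tendsto (fun k => ‖r k - x‖) U (𝓝 0) := by
    have := (h.tendsto.sub_const x).norm
    rwa [sub_self, norm_zero] at this
  have hd2 := h.dist_eq'
  rw [dist_eq_norm] at hd2
  apply le_antisymm
  · have h1 : ∀ᶠ k in U,
        2 * inner ℝ (r k - p k) (‖r k - x‖⁻¹ • (r k - x)) ≤ ‖r k - x‖ := by
      filter_upwards [h.ne] with k hk
      have hpos : 0 < ‖r k - x‖ := norm_pos_iff.2 (sub_ne_zero.2 hk)
      have h2 : d ≤ dist x (p k) := by
        rw [← h.dist_eq']
        exact h.mem'.2 _ (h.mem k).1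
      have h3 : x - p k = (r k - p k) - (r k - x) := by abel
      rw [dist_eq_norm, h3] at h2
      have h4 := pow_le_pow_left₀ h.pos.le h2 2
      rw [norm_sub_sq_real, ← dist_eq_norm, h.dist_eq k] at h4
      rw [inner_smul_right, ← mul_assoc, mul_comm 2, mul_assoc, inv_mul_le_iff₀ hpos]
      linarith
    have h2 := le_of_tendsto_of_tendsto
      (((h.tendsto.sub h.tendsto').inner hv).const_mul 2) hδ h1
    linarith
  · have h1 : ∀ᶠ k in U,
        -‖r k - x‖ ≤ 2 * inner ℝ (x - y) (‖r k - x‖⁻¹ • (r k - x)) := by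
      filter_upwards [h.ne] with k hk
      have hpos : 0 < ‖r k - x‖ := norm_pos_iff.2 (sub_ne_zero.2 hk)
      have h2 : d ≤ dist (r k) y := by
        rw [← h.dist_eq k]
        exact (h.mem k).2 _ h.mem'.1
      have h3 : r k - y = (x - y) + (r k - x) := by abel
      rw [dist_eq_norm, h3] at h2
      have h4 := pow_le_pow_left₀ h.pos.le h2 2
      rw [norm_add_sq_real, hd2] at h4
      rw [inner_smul_right, ← mul_assoc, mul_comm 2, mul_assoc, le_inv_mul_iff₀ hpos]
      linarith
    have h2 := le_of_tendsto_of_tendsto hδ.neg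
      ((tendsto_const_nhds.inner hv).const_mul 2) h1
    linarith

theorem mem_frontier_of_forall_notMem {p q : Plane} (hp : p ∈ E)
    (h : ∀ s ∈ Ioo (0 : ℝ) 1, p + s • (q - p) ∉ E) : p ∈ frontier E := by
  refine ⟨subset_closure hp, fun hint => ?_⟩
  have hc : Tendsto (fun s : ℝ => p + s • (q - p)) (𝓝[>] 0) (𝓝 p) := by
    have : Continuous fun s : ℝ => p + s • (q - p) := by fun_prop
    have h0 := this.tendsto 0
    simp only [zero_smul, add_zero] at h0
    exact h0.mono_left nhdsWithin_le_nhds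
  obtain ⟨s, hs, hs1⟩ := ((hc.eventually (mem_interior_iff_mem_nhds.1 hint)).and
    (Ioo_mem_nhdsGT one_pos)).exists
  exact h s hs1 hs

theorem mem_frontier_of_mem_projections {r p : Plane} (h : p ∈ projections r E) (hne : r ≠ p) :
    p ∈ frontier E := by
  refine mem_frontier_of_forall_notMem (q := r) h.1 fun s hs hsE => ?_
  have h1 := h.2 _ hsE
  have h2 : r - (p + s • (r - p)) = (1 - s) • (r - p) := by rw [sub_smul, one_smul]; abel
  rw [dist_eq_norm, dist_eq_norm, h2, norm_smul, Real.norm_of_nonneg (sub_pos.2 hs.2).le] at h1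
  have h3 : 0 < ‖r - p‖ := norm_pos_iff.2 (sub_ne_zero.2 hne)
  have h4 := mul_pos hs.1 h3
  linarith

theorem IsArcNetwork.isNormalAt_of_mem_projections (h : IsArcNetwork V c)
    (hE : arcSupport V c ⊆ E) {x y : Plane} (hy : y ∈ arcSupport V c)
    (hx : y ∈ projections x E) : IsNormalAt V c y (x - y) := by
  rcases mem_arcSupport.1 hy with hV | ⟨j, t, ht, rfl⟩
  · exact Or.inl hV
  · refine Or.inr ⟨j, t, ht, rfl, ?_⟩
    refine inner_eq_zero_of_mem_projections
      (h.analyticAt j (Ioo_subset_Icc_self ht)).differentiableAt ?_ hx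
    filter_upwards [isOpen_Ioo.mem_nhds ht] with u hu
    exact hE (h.mem_arcSupport_of_mem_Icc j (Ioo_subset_Icc_self hu))

theorem IsNormalAt.smul {p w : Plane} (h : IsNormalAt V c p w) (a : ℝ) :
    IsNormalAt V c p (a • w) := by
  refine h.imp_right ?_
  rintro ⟨j, t, ht, hp, h0⟩
  exact ⟨j, t, ht, hp, by rw [real_inner_smul_left, h0, mul_zero]⟩

/-- If infinitely many points at the distance `d` from `E` have several nearest points, then a
segment of length `2 * d` is normal to the boundary of `E` at both end-points. -/
theorem IsArcNetwork.exists_doubleNormal_of_infinite [Finite ι] (h : IsArcNetwork V c)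
    (hE : arcSupport V c ⊆ E) (hcl : IsClosed E) (hfr : frontier E ⊆ arcSupport V c) {d : ℝ}
    (hd : 0 < d)
    (hinf : {r | Metric.infDist r E = d ∧ ¬∃ p, projections r E = {p}}.Infinite) :
    ∃ p q, p ≠ q ∧ IsNormalAt V c p (q - p) ∧ IsNormalAt V c q (q - p) ∧ dist p q = 2 * d := by
  have hproj : ∀ r, Metric.infDist r E = d → ∀ p, p ∈ projections r E ↔ p ∈ E ∧ dist r p = d := by
    intro r hr p
    constructor
    · rintro ⟨hp, hmin⟩
      refine ⟨hp, le_antisymm ?_ (hr ▸ Metric.infDist_le_dist_of_mem hp)⟩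
      rw [← hr]
      exact (Metric.le_infDist ⟨p, hp⟩).2 fun _ hq => hmin _ hq
    · rintro ⟨hp, hd⟩
      exact ⟨hp, fun q hq => by rw [hd, ← hr]; exact Metric.infDist_le_dist_of_mem hq⟩
  have htwo : ∀ r, Metric.infDist r E = d → (¬∃ p, projections r E = {p}) →
      ∃ p q, p ≠ q ∧ p ∈ projections r E ∧ q ∈ projections r E := by
    intro r hr hn
    have hne : E.Nonempty := by
      rw [nonempty_iff_ne_empty]
      rintro rfl
      rw [Metric.infDist_empty] at hr
      exact hd.ne hr
    obtain ⟨p, hp, hrp⟩ := hcl.exists_infDist_eq_dist hne r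
    have hp' : p ∈ projections r E := (hproj r hr p).2 ⟨hp, by rw [← hrp, hr]⟩
    by_contra! hall
    exact hn ⟨p, Subset.antisymm (fun q hq => by_contra fun hqp => hall p q (Ne.symm hqp) hp' hq)
      (singleton_subset_iff.2 hp')⟩
  set r : ℕ → Plane := fun k => hinf.natEmbedding _ k with hr
  have hrinj : Function.Injective r :=
    Subtype.val_injective.comp (hinf.natEmbedding _).injective
  have hrS : ∀ k, Metric.infDist (r k) E = d ∧ ¬∃ p, projections (r k) E = {p} :=
    fun k => (hinf.natEmbedding _ k).2
  choose p q hpq hp hq using fun k => htwo (r k) (hrS k).1 (hrS k).2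
  have hdp : ∀ k, dist (r k) (p k) = d := fun k => ((hproj _ (hrS k).1 _).1 (hp k)).2
  have hdq : ∀ k, dist (r k) (q k) = d := fun k => ((hproj _ (hrS k).1 _).1 (hq k)).2
  have hsupp : ∀ {a b : Plane}, dist a b = d → b ∈ projections a E → b ∈ arcSupport V c := by
    intro a b hab hb
    refine hfr (mem_frontier_of_mem_projections hb ?_)
    rintro rfl
    rw [dist_self] at hab
    exact hd.ne hab
  have hps : ∀ k, p k ∈ arcSupport V c := fun k => hsupp (hdp k) (hp k)
  have hqs : ∀ k, q k ∈ arcSupport V c := fun k => hsupp (hdq k) (hq k)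
  set U := hyperfilter ℕ with hU
  obtain ⟨y, hy, hpy⟩ := exists_tendsto_of_eventually_mem (U := U) h.isCompact_arcSupport
    (Eventually.of_forall hps)
  obtain ⟨z, hz, hqz⟩ := exists_tendsto_of_eventually_mem (U := U) h.isCompact_arcSupport
    (Eventually.of_forall hqs)
  obtain ⟨n, -, hn⟩ := exists_tendsto_of_eventually_mem (U := U) (f := fun k => r k - p k)
    (isCompact_closedBall (0 : Plane) d) (Eventually.of_forall fun k => by
      rw [mem_closedBall_zero_iff, ← dist_eq_norm, hdp k])
  obtain ⟨x, hrx⟩ : ∃ x, Tendsto r U (𝓝 x) := ⟨n + y, by simpa using hn.add hpy⟩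
  have hrne : ∀ᶠ k in U, r k ≠ x := by
    have h1 : {k | r k = x}.Finite :=
      (finite_singleton x).preimage hrinj.injOn
    exact compl_mem_hyperfilter_of_finite h1
  obtain ⟨v, hv, hrv⟩ := exists_tendsto_of_eventually_mem (U := U)
    (f := fun k => ‖r k - x‖⁻¹ • (r k - x)) (isCompact_sphere (0 : Plane) 1) (by
      filter_upwards [hrne] with k hk
      rw [mem_sphere_zero_iff_norm, norm_smul, norm_inv, norm_norm,
        inv_mul_cancel₀ (norm_ne_zero_iff.2 (sub_ne_zero.2 hk))])
  have hxd : Metric.infDist x E = d :=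
    tendsto_nhds_unique (((Metric.continuous_infDist_pt E).tendsto x).comp hrx)
      (tendsto_const_nhds.congr fun k => (hrS k).1.symm)
  have hxy : dist x y = d :=
    tendsto_nhds_unique (hrx.dist hpy) (tendsto_const_nhds.congr fun k => (hdp k).symm)
  have hxz : dist x z = d :=
    tendsto_nhds_unique (hrx.dist hqz) (tendsto_const_nhds.congr fun k => (hdq k).symm)
  have hyE : y ∈ projections x E := (hproj x hxd y).2 ⟨hE hy, hxy⟩
  have hzE : z ∈ projections x E := (hproj x hxd z).2 ⟨hE hz, hxz⟩
  have hP : IsNearestSeq E d U r p x y := ⟨hd, hrx, hrne, hpy, hdp, hp, hxy, hyE⟩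
  have hQ : IsNearestSeq E d U r q x z := ⟨hd, hrx, hrne, hqz, hdq, hq, hxz, hzE⟩
  have hv0 : v ≠ 0 := by
    rintro rfl
    simp at hv
  rcases eq_or_eq_neg_of_inner_eq_zero hv0 (hP.inner_direction_eq_zero hrv)
    (hQ.inner_direction_eq_zero hrv) (by rw [← dist_eq_norm, ← dist_eq_norm, hxy, hxz])
    with heq | heq
  · have hyz : y = z := sub_right_injective heq
    subst hyz
    exact (h.false_of_collapse hE hps hqs hpq hP hQ).elim
  · have h1 : z - y = (2 : ℝ) • (x - y) := by
      have : z - y = (x - y) - (x - z) := by abel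
      rw [this, two_smul, heq]; abel
    have h2 : z - y = (-2 : ℝ) • (x - z) := by rw [h1, heq]; module
    have h3 : dist y z = 2 * d := by
      rw [dist_comm, dist_eq_norm, h1, norm_smul, ← dist_eq_norm, hxy]; norm_num
    refine ⟨y, z, ?_, ?_, ?_, h3⟩
    · rintro rfl
      rw [dist_self] at h3
      linarith
    · rw [h1]
      exact (h.isNormalAt_of_mem_projections hE hy hyE).smul 2
    · rw [h2]
      exact (h.isNormalAt_of_mem_projections hE hz hzE).smul (-2)

end Network

/-! ### The network of a scene -/

theorem IsPiecewiseAnalyticJordanLoop.exists_isArcNetwork {L : Set Plane}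
    (h : IsPiecewiseAnalyticJordanLoop L) :
    ∃ (n : ℕ) (V : Set Plane) (c : Fin n → ℝ → Plane), IsArcNetwork V c ∧ arcSupport V c = L := by
  obtain ⟨n, hn, γ, hreg, hnext, hinj, rfl⟩ := h
  have h0 : (0 : ℝ) ∈ Ico (0 : ℝ) 1 := ⟨le_rfl, one_pos⟩
  have hnet : IsArcNetwork (range fun j => γ j 0) γ := by
    refine ⟨finite_range _, hreg, fun j => ⟨j, rfl⟩, fun j => ⟨j + 1, (hnext j).symm⟩, ?_, ?_⟩
    · rintro j t ht ⟨i, hi⟩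
      exact ht.1.ne (hinj i j 0 h0 t (Ioo_subset_Ico_self ht) hi).2
    · exact fun i j s hs t ht => hinj i j s (Ioo_subset_Ico_self hs) t (Ioo_subset_Ico_self ht)
  refine ⟨n, _, γ, hnet, ?_⟩
  rw [hnet.arcSupport_eq, union_eq_right]
  rintro _ ⟨j, rfl⟩
  exact mem_iUnion.2 ⟨j, 0, left_mem_Icc.2 zero_le_one, rfl⟩

section Scene
variable {N : ℕ} {D : Fin N → Set Plane}

theorem isClosed_of_isObject {A : Set Plane} (h : IsPointObject A ∨ IsExtendedObject A) :
    IsClosed A := by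
  rcases h with ⟨p, rfl⟩ | h
  · exact isClosed_singleton
  · exact h.1

theorem exists_isArcNetwork_of_isObject {A : Set Plane}
    (h : IsPointObject A ∨ IsExtendedObject A) :
    ∃ (n : ℕ) (V : Set Plane) (c : Fin n → ℝ → Plane), IsArcNetwork V c ∧
      arcSupport V c = frontier A ∧ ∀ _ : Fin n, IsExtendedObject A := by
  rcases h with ⟨p, rfl⟩ | h
  · refine ⟨0, {p}, fun _ _ => p, ⟨finite_singleton p, nofun, nofun, nofun, nofun, nofun⟩, ?_,
      nofun⟩
    rw [isClosed_singleton.frontier_eq, interior_singleton, sdiff_empty, arcSupport,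
      iUnion_of_empty, union_empty]
  · obtain ⟨n, V, c, hnet, hsupp⟩ := h.2.2.exists_isArcNetwork
    exact ⟨n, V, c, hnet, hsupp, fun _ => h⟩

/-- The boundaries of the objects of a scene form a single network, the point-wise objects being its
isolated vertices. -/
theorem exists_isArcNetwork_of_scene
    (hobj : ∀ i, IsPointObject (D i) ∨ IsExtendedObject (D i))
    (hdisj : ∀ i j, i ≠ j → Disjoint (D i) (D j)) :
    ∃ (ι : Type) (_ : Finite ι) (V : Set Plane) (c : ι → ℝ → Plane), IsArcNetwork V c ∧
      arcSupport V c = ⋃ i, frontier (D i) ∧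
      ∀ j, ∃ i, IsExtendedObject (D i) ∧ c j '' Ioo (0 : ℝ) 1 ⊆ frontier (D i) := by
  choose n V c hnet hsupp hext using fun i => exists_isArcNetwork_of_isObject (hobj i)
  have heq : ∀ {i j : Fin N} {x : Plane}, x ∈ arcSupport (V i) (c i) →
      x ∈ arcSupport (V j) (c j) → i = j := by
    intro i j x hi hj
    rw [hsupp] at hi hj
    by_contra hij
    exact disjoint_left.1 (hdisj i j hij) ((isClosed_of_isObject (hobj i)).frontier_subset hi)
      ((isClosed_of_isObject (hobj j)).frontier_subset hj)
  have hmem : ∀ i j, ∀ t ∈ Ioo (0 : ℝ) 1, c i j t ∈ arcSupport (V i) (c i) :=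
    fun i j t ht => (hnet i).mem_arcSupport_of_mem_Icc j (Ioo_subset_Icc_self ht)
  refine ⟨Σ i, Fin (n i), inferInstance, ⋃ i, V i, fun x => c x.1 x.2, ⟨?_, ?_, ?_, ?_, ?_, ?_⟩,
    ?_, ?_⟩
  · exact finite_iUnion fun i => (hnet i).finite_vertices
  · exact fun x => (hnet x.1).regular x.2
  · exact fun x => mem_iUnion.2 ⟨x.1, (hnet x.1).left_mem x.2⟩
  · exact fun x => mem_iUnion.2 ⟨x.1, (hnet x.1).right_mem x.2⟩
  · rintro ⟨i, j⟩ t ht hV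
    obtain ⟨i', hi'⟩ := mem_iUnion.1 hV
    obtain rfl := heq (hmem i j t ht) (Or.inl hi')
    exact (hnet i).notMem j t ht hi'
  · rintro ⟨i, j⟩ ⟨i', j'⟩ s hs t ht hst
    simp only at hst
    obtain rfl := heq (hmem i j s hs) (hst ▸ hmem i' j' t ht)
    obtain ⟨rfl, h⟩ := (hnet i).inj j j' s hs t ht hst
    exact ⟨rfl, h⟩
  · simp only [← hsupp, arcSupport, iUnion_union_distrib, iUnion_sigma]
  · rintro ⟨i, j⟩
    refine ⟨i, hext i j, ?_⟩
    rintro _ ⟨t, ht, rfl⟩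
    exact hsupp i ▸ hmem i j t ht

theorem IsBridge.symm {k : WithTop ℕ∞} {p q : Plane} (h : IsBridge k D p q) :
    IsBridge k D q p := by
  refine ⟨by rw [segment_symm, h.1, pair_comm], fun i hi γ a b hγ t ht htpq => ?_⟩
  rw [← neg_sub, inner_neg_left, h.2 i hi γ a b hγ t ht htpq.symm, neg_zero]

theorem IsBridge.mem_frontier {k : WithTop ℕ∞} {p q : Plane} (h : IsBridge k D p q)
    (hne : p ≠ q) : p ∈ frontier (⋃ i, D i) := by
  have hp : p ∈ segment ℝ p q ∩ ⋃ i, D i := h.1 ▸ mem_insert p {q}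
  refine mem_frontier_of_forall_notMem (q := q) hp.2 fun s hs hsD => ?_
  have hseg : p + s • (q - p) ∈ segment ℝ p q := by
    rw [segment_eq_image']
    exact ⟨s, Ioo_subset_Icc_self hs, rfl⟩
  have h1 : p + s • (q - p) ∈ ({p, q} : Set Plane) := h.1 ▸ ⟨hseg, hsD⟩
  have h2 : q - p ≠ 0 := sub_ne_zero.2 hne.symm
  rcases h1 with h1 | h1
  · rw [add_eq_left, smul_eq_zero] at h1
    exact h1.elim hs.1.ne' h2
  · have h3 : (1 - s) • (q - p) = 0 := by
      rw [sub_smul, one_smul, sub_eq_zero, ← sub_eq_iff_eq_add'.2 h1.symm]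
    exact (smul_eq_zero.1 h3).elim (sub_pos.2 hs.2).ne' h2

end Scene
end PlanarScene

end

theorem proposition1 (k : WithTop ℕ∞) (hk : 1 ≤ k) (N : ℕ) (D : Fin N → Set PlanarScene.Plane)
    (hobj : ∀ i, PlanarScene.IsPointObject (D i) ∨ PlanarScene.IsExtendedObject (D i))
    (hdisj : ∀ i j, i ≠ j → Disjoint (D i) (D j)) :
    {d : ℝ | PlanarScene.IsBizarre k D d}.Finite := by
  open PlanarScene in
  obtain ⟨ι, _, V, c, hnet, hsupp, hext⟩ := exists_isArcNetwork_of_scene hobj hdisj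
  have hclosed : ∀ i, IsClosed (D i) := fun i => isClosed_of_isObject (hobj i)
  have hE : arcSupport V c ⊆ ⋃ i, D i := by
    rw [hsupp]
    exact iUnion_mono fun i => (hclosed i).frontier_subset
  have hcl : IsClosed (⋃ i, D i) := isClosed_iUnion_of_finite hclosed
  have hfr : frontier (⋃ i, D i) ⊆ arcSupport V c := by
    intro x hx
    rw [hcl.frontier_eq] at hx
    obtain ⟨i, hi⟩ := mem_iUnion.1 hx.1
    rw [hsupp, mem_iUnion]
    refine ⟨i, ?_⟩
    rw [(hclosed i).frontier_eq]
    exact ⟨hi, fun h => hx.2 (interior_mono (subset_iUnion D i) h)⟩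
  refine (hnet.finite_curvature_radii.union
    (hnet.finite_doubleNormal_lengths.image (· / 2))).subset ?_
  have hlen : ∀ d : ℝ, (∃ p q, p ≠ q ∧ IsNormalAt V c p (q - p) ∧ IsNormalAt V c q (q - p) ∧
      dist p q = 2 * d) → d ∈ (fun l : ℝ => l / 2) '' {l : ℝ | ∃ p q, p ≠ q ∧
        IsNormalAt V c p (q - p) ∧ IsNormalAt V c q (q - p) ∧ dist p q = l} := fun d h =>
    ⟨2 * d, h, by simp⟩
  rintro d ⟨hd, ⟨i, -, hinf⟩ | hinf | ⟨p, q, hpq, hdist⟩⟩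
  · refine Or.inl ⟨hd, (hinf.sdiff hnet.finite_vertices).mono ?_⟩
    rintro x ⟨⟨-, γ, a, b, hγ, hsub, -, hx⟩, hxV⟩
    obtain ⟨s, hs, rfl, hκ⟩ : ∃ s, (s = a ∨ s = b) ∧ x = γ s ∧ -d⁻¹ = signedCurvature γ s := by
      rcases hx with hx | hx
      · exact ⟨a, Or.inl rfl, hx⟩
      · exact ⟨b, Or.inr rfl, hx⟩
    obtain ⟨j, t, ht, hjt, habs⟩ := hnet.exists_abs_signedCurvature_eq hγ
      (hsub.trans (by rw [hsupp]; exact subset_iUnion (fun i => frontier (D i)) i)) hs hxV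
    exact ⟨j, t, ht, hjt, by rw [habs, ← hκ, abs_neg, abs_of_pos (inv_pos.2 hd)]⟩
  · exact Or.inr (hlen d (hnet.exists_doubleNormal_of_infinite hE hcl hfr hd
      (hinf.mono fun r hr => hr.2)))
  · have hne : p ≠ q := by
      rintro rfl
      rw [dist_self] at hdist
      linarith
    have hnormal : ∀ {p q : Plane}, IsBridge k D p q → p ≠ q → IsNormalAt V c p (q - p) := by
      intro p q h hne
      refine (mem_arcSupport.1 (hfr (h.mem_frontier hne))).imp_right ?_
      rintro ⟨j, t, ht, hjt⟩
      obtain ⟨i, hi, hsub⟩ := hext j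
      refine ⟨j, t, ht, hjt, h.2 i hi (c j) 0 1 ⟨?_, ?_, ?_, hsub⟩ t ht (Or.inl hjt)⟩
      · exact fun s hs =>
          (hnet.analyticAt j (Ioo_subset_Icc_self hs)).contDiffAt.contDiffWithinAt
      · exact fun s hs => hnet.deriv_ne_zero j (Ioo_subset_Icc_self hs)
      · exact fun s hs t ht hst => (hnet.inj j j s hs t ht hst).2
    refine Or.inr (hlen d ⟨p, q, hne, hnormal hpq hne, ?_, hdist⟩)
    have := (hnormal hpq.symm hne.symm).smul (-1)
    rwa [neg_one_smul, neg_sub] at this
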